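/- **Setting.** Let $G=(V,E)$ be a finite undirected graph with source-sink pairs $(s_1,t_1),\dots,(s_r,t_r)$, let $k\ge 2$ be an integer, and let every node have cost $1$. A *terminal* is a node among $s_1,t_1,\dots,s_r,t_r$. Two nodes are *at least* (*less than*) *$c$-node-connected* in $(S,E(S))$ if the maximum number of pairwise internally node-disjoint simple paths between them with all nodes in $S$ is $\ge c$ ($<c$). A *feasible solution* of node-deletion $k$-route node-multicut is a set $A\subseteq V$ of non-terminals such that $(V\setminus A,E(V\setminus A))$ has at most $k-1$ node-disjoint $s_i$-$t_i$ paths for all $i$. The LP relaxation is: minimize $\sum_v x_v$ over $x,y^1,\dots,y^r\ge 0$ subject to $\sum_{v\in V(P)}(x_v+y^i_v)\ge 1$ for every $i$ and every simple $s_i$-$t_i$ path $P$; $\sum_v y^i_v\le k-1$ and $y^i_{s_i}=y^i_{t_i}=0$ for every $i$; $x_v=0$ for every terminal $v$. Let $(x,\{y^i\})$ be an optimal solution, $OPT=\sum_v x_v$ and $\beta=OPT/r$. **Region growing.** Let $\ell^i(u;v)$ be the minimum of $\sum_{w\in V(P),\,w\ne u}(x_w+y^i_w)$ over $u$-$v$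 paths $P$ ($+\infty$ if there is none). For $S\subseteq V$, a commodity $i$ and $\rho\ge 0$ let $B=\{v\in S:\ell^i(s_i;v)\le\rho\}$; let $\Gamma$ be the set of nodes of $S\setminus B$ with a neighbour in $B$; $\Gamma^x=\{v\in\Gamma:\rho+y^i_v<\ell^i(s_i;v)\le \rho+x_v+y^i_v\}$; $\Gamma^y=\{v\in\Gamma:\rho<\ell^i(s_i;v)\le\rho+y^i_v\}$; $\overline B=S\setminus(B\cup\Gamma)$; and $$\mathcal V(S)=\beta+\sum_{v\in S}x_v,\qquad \mathcal V=\beta+\sum_{v\in B\cup\Gamma^y}x_v+\sum_{v\in\Gamma^x}\bigl(\rho-(\ell^i(s_i;v)-x_v-y^i_v)\bigr),$$ $$\overline{\mathcal V}=\beta+\sum_{v\in\overline B\cup\Gamma^y}x_v+\sum_{v\in\Gamma^x}\bigl(\ell^i(s_i;v)-y^i_v-\rho\bigr).$$ For $\gamma>1$, call $\rho\in[0,1)$ *good* for $(S,i)$ if, for both $W=\mathcal V$ and $W=\overline{\mathcal V}$, $|\Gamma|\le\frac{2\gamma}{(\sqrt\gamma-1)^2}\,W\ln\bigl(\tfrac{e\,\mathcal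 V(S)}{W}\bigr)\ln\ln(e(r+1))$. **Algorithm ND-$k$-NMCAlg$(U,\mathcal T)$.** Start with $S=U$, $Z=\emptyset$, $\mathcal S=\emptyset$. While some pair of $\mathcal T$ is at least $\gamma(k-1)$-node-connected in $(S,E(S))$: pick such a pair $(s_i,t_i)$ and a good $\rho$ for $(S,i)$; let $A=B$ if $B\cup\Gamma^y$ contains at most $|\mathcal T|/2$ pairs of $\mathcal T$, and $A=\overline B$ otherwise; add $A$ to $\mathcal S$, add $\Gamma$ to $Z$, and replace $S$ by $S\setminus(A\cup\Gamma)$. When the loop ends, for every $A\in\mathcal S$ add to $Z$ the output of the algorithm on $A$ and the pairs of $\mathcal T$ with both ends in $A$. Return $Z$. The initial call is $(V,\{(s_1,t_1),\dots,(s_r,t_r)\})$. **Theorem.** There is an absolute constant $C>0$ such that, for every instance as above (with $k\ge2$) and every optimal solution $(x,\{y^i\})$ of the LP, the following holds, with $\Lambda(r)=\ln(\max\{r,3\})\cdot\ln\ln(\max\{r,3\})$. 1. For every $\gamma>1$: whenever $s_i,t_i$ are at least $\gamma(k-1)$-node-connected in $(S,E(S))$, $S\subseteq V$, there is a good radius for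 $(S,i)$, and the algorithm has an output. Whatever pairs and good radii are chosen, its output $Z$ satisfies $|Z|\le C\,\frac{\gamma}{(\sqrt\gamma-1)^2}\,\Lambda(r)\cdot OPT$, and every pair $s_i,t_i$ is less than $\gamma(k-1)$-node-connected in $(V\setminus Z,E(V\setminus Z))$. 2. For $\gamma=\frac{k}{k-1}$, every output $Z$ satisfies $|Z|\le C\,(k-1)^2\,\Lambda(r)\cdot OPT$, and $(V\setminus Z,E(V\setminus Z))$ has at most $k-1$ node-disjoint $s_i$-$t_i$ paths for all $i$. A terminal $v$ can belong to $Z$ only if $y^i_v>0$ for some $i$; so if all $y^i$ vanish on the terminals, $Z$ is a feasible solution. -/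

import Mathlib

universe u

/-- The data of a node-deletion `k`-route node-multicut instance with unit node costs on the
node set `V`: an undirected graph, `r` source-sink pairs, and the connectivity bound `k`. -/
structure NodeMulticut (V : Type u) where
  graph : SimpleGraph V
  r : ℕ
  s : Fin r → V
  t : Fin r → V
  k : ℕ

namespace NodeMulticut

variable {V : Type u} (I : NodeMulticut V)

/-- `v` is one of `s_1, t_1, …, s_r, t_r`. -/
def IsTerminal (v : V) : Prop := ∃ i, v = I.s i ∨ v = I.t i

/-- A finite set of pairwise (internally) node-disjoint simple `a`-`b` paths, all of whose nodes
lie in `S`, that is, paths of the induced subgraph `(S, E(S))`. -/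
def NodeDisjoint (S : Finset V) {a b : V} (P : Finset (I.graph.Path a b)) : Prop :=
  (∀ p ∈ P, ∀ w ∈ p.1.support, w ∈ S) ∧
  ∀ p ∈ P, ∀ q ∈ P, p ≠ q → ∀ w ∈ p.1.support, w ∈ q.1.support → w = a ∨ w = b

/-- `a` and `b` are at least `c`-node-connected in `(S, E(S))`. -/
def ConnAtLeast (S : Finset V) (a b : V) (c : ℝ) : Prop :=
  ∃ P : Finset (I.graph.Path a b), I.NodeDisjoint S P ∧ c ≤ (P.card : ℝ)

/-- `a` and `b` are less than `c`-node-connected in `(S, E(S))`. -/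
def ConnLess (S : Finset V) (a b : V) (c : ℝ) : Prop :=
  ∀ P : Finset (I.graph.Path a b), I.NodeDisjoint S P → (P.card : ℝ) < c

variable [Fintype V] [DecidableEq V]

/-- After deleting `Z`, there are at most `k - 1` node-disjoint `s_i`-`t_i` paths, for all `i`. -/
def MeetsConnectivity (Z : Finset V) : Prop :=
  ∀ i, ∀ P : Finset (I.graph.Path (I.s i) (I.t i)),
    I.NodeDisjoint (Finset.univ \ Z) P → P.card ≤ I.k - 1

/-- Feasible solutions of the problem: node sets without terminals whose deletion leaves at most
`k - 1` node-disjoint `s_i`-`t_i` paths for all `i`. -/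
def IsFeasible (Z : Finset V) : Prop :=
  (∀ v ∈ Z, ¬ I.IsTerminal v) ∧ I.MeetsConnectivity Z

/-- Feasible points `(x, {yⁱ})` of the linear programming relaxation. -/
structure LPFeasible (x : V → ℝ) (y : Fin I.r → V → ℝ) : Prop where
  x_nonneg : ∀ v, 0 ≤ x v
  y_nonneg : ∀ i v, 0 ≤ y i v
  path : ∀ i, ∀ p : I.graph.Path (I.s i) (I.t i),
    1 ≤ (p.1.support.map fun v => x v + y i v).sum
  budget : ∀ i, ∑ v, y i v ≤ (I.k : ℝ) - 1
  y_source : ∀ i, y i (I.s i) = 0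
  y_sink : ∀ i, y i (I.t i) = 0
  x_terminal : ∀ v, I.IsTerminal v → x v = 0

/-- Optimal solutions of the linear program, whose objective is `∑ v, x v` (unit costs). -/
def LPOptimal (x : V → ℝ) (y : Fin I.r → V → ℝ) : Prop :=
  I.LPFeasible x y ∧ ∀ x' y', I.LPFeasible x' y' → ∑ v, x v ≤ ∑ v, x' v

variable (x : V → ℝ) (y : Fin I.r → V → ℝ)

/-- `ℓⁱ(a; b)`: the minimum over `a`-`b` paths of the total `x + yⁱ` of all nodes other than the
first one. It is used only for `b` reachable from `a`. -/
noncomputable def ell (i : Fin I.r) (a b : V) : ℝ :=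
  ⨅ p : I.graph.Path a b, (p.1.support.tail.map fun w => x w + y i w).sum

open Classical in
/-- The ball `B^S_i(z, ρ)`. -/
noncomputable def ball (S : Finset V) (i : Fin I.r) (z : V) (ρ : ℝ) : Finset V :=
  S.filter fun v => I.graph.Reachable z v ∧ I.ell x y i z v ≤ ρ

open Classical in
/-- The boundary `Γ^S_i(z, ρ)`: the nodes of `S` outside the ball with a neighbour in the ball. -/
noncomputable def bdry (S : Finset V) (i : Fin I.r) (z : V) (ρ : ℝ) : Finset V :=
  (S \ I.ball x y S i z ρ).filter fun v => ∃ w ∈ I.ball x y S i z ρ, I.graph.Adj w v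

open Classical in
/-- The `x`-boundary: the boundary nodes with `ρ + yⁱ_v < ℓⁱ(z; v) ≤ ρ + x_v + yⁱ_v`. -/
noncomputable def xBdry (S : Finset V) (i : Fin I.r) (z : V) (ρ : ℝ) : Finset V :=
  (I.bdry x y S i z ρ).filter fun v =>
    ρ + y i v < I.ell x y i z v ∧ I.ell x y i z v ≤ ρ + x v + y i v

open Classical in
/-- The `y`-boundary: the boundary nodes with `ρ < ℓⁱ(z; v) ≤ ρ + yⁱ_v`. -/
noncomputable def yBdry (S : Finset V) (i : Fin I.r) (z : V) (ρ : ℝ) : Finset V :=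
  (I.bdry x y S i z ρ).filter fun v =>
    ρ < I.ell x y i z v ∧ I.ell x y i z v ≤ ρ + y i v

/-- The rest of `S`, outside the ball and its boundary. -/
noncomputable def coBall (S : Finset V) (i : Fin I.r) (z : V) (ρ : ℝ) : Finset V :=
  S \ (I.ball x y S i z ρ ∪ I.bdry x y S i z ρ)

/-- `β = OPT / r`, where `OPT = ∑ v, x v`. -/
noncomputable def beta : ℝ := (∑ v, x v) / (I.r : ℝ)

/-- The volume of the region `S`. -/
noncomputable def regionVol (S : Finset V) : ℝ := I.beta x + ∑ v ∈ S, x v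

/-- The volume of the ball. -/
noncomputable def ballVol (S : Finset V) (i : Fin I.r) (z : V) (ρ : ℝ) : ℝ :=
  I.beta x + ∑ v ∈ I.ball x y S i z ρ ∪ I.yBdry x y S i z ρ, x v
    + ∑ v ∈ I.xBdry x y S i z ρ, (ρ - (I.ell x y i z v - x v - y i v))

/-- The volume of the complement of the ball. -/
noncomputable def coBallVol (S : Finset V) (i : Fin I.r) (z : V) (ρ : ℝ) : ℝ :=
  I.beta x + ∑ v ∈ I.coBall x y S i z ρ ∪ I.yBdry x y S i z ρ, x v
    + ∑ v ∈ I.xBdry x y S i z ρ, (I.ell x y i z v - y i v - ρ)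

/-- The radii that the region-growing step of the algorithm may use: the size of the boundary is
bounded in terms of both volumes. -/
def GoodRadius (γ : ℝ) (S : Finset V) (i : Fin I.r) (ρ : ℝ) : Prop :=
  0 ≤ ρ ∧ ρ < 1 ∧
  ((I.bdry x y S i (I.s i) ρ).card : ℝ) ≤
    2 * γ / (√γ - 1) ^ 2 * I.ballVol x y S i (I.s i) ρ
      * Real.log (Real.exp 1 * I.regionVol x S / I.ballVol x y S i (I.s i) ρ)
      * Real.log (Real.log (Real.exp 1 * ((I.r : ℝ) + 1))) ∧
  ((I.bdry x y S i (I.s i) ρ).card : ℝ) ≤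
    2 * γ / (√γ - 1) ^ 2 * I.coBallVol x y S i (I.s i) ρ
      * Real.log (Real.exp 1 * I.regionVol x S / I.coBallVol x y S i (I.s i) ρ)
      * Real.log (Real.log (Real.exp 1 * ((I.r : ℝ) + 1)))

/-- The pairs of `T` with both ends in `A`. -/
def pairsIn (T : Finset (Fin I.r)) (A : Finset V) : Finset (Fin I.r) :=
  T.filter fun i => I.s i ∈ A ∧ I.t i ∈ A

/-- The carved-out set: the ball if the ball together with the `y`-boundary contains at most
half of the pairs of `T`, and the complement otherwise. -/
noncomputable def carve (T : Finset (Fin I.r)) (S : Finset V) (i : Fin I.r) (ρ : ℝ) : Finset V :=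
  if 2 * (I.pairsIn T (I.ball x y S i (I.s i) ρ ∪ I.yBdry x y S i (I.s i) ρ)).card ≤ T.card
  then I.ball x y S i (I.s i) ρ else I.coBall x y S i (I.s i) ρ

/-- The states `(S, 𝒮, Z)` that the while loop of the call with arguments `(U, T)` can reach: `S`
is the current region, `𝒮` the collection of carved-out sets, `Z` the set of deleted nodes. An
iteration picks a pair of `T` that is still at least `γ(k-1)`-node-connected in `S` and a good
radius, deletes the boundary and carves out one side. -/
inductive LoopReaches (γ : ℝ) (U : Finset V) (T : Finset (Fin I.r)) :
    Finset V → Finset (Finset V) → Finset V → Prop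
  | start : LoopReaches γ U T U ∅ ∅
  | step (S : Finset V) (C : Finset (Finset V)) (Z : Finset V) (i : Fin I.r) (ρ : ℝ) :
      LoopReaches γ U T S C Z → i ∈ T →
      I.ConnAtLeast S (I.s i) (I.t i) (γ * ((I.k : ℝ) - 1)) →
      I.GoodRadius x y γ S i ρ →
      LoopReaches γ U T (S \ (I.carve x y T S i ρ ∪ I.bdry x y S i (I.s i) ρ))
        (insert (I.carve x y T S i ρ) C) (Z ∪ I.bdry x y S i (I.s i) ρ)

/-- `Returns γ U T Z`: the recursive algorithm, called with the node set `U` and the pairs `T`,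
can return `Z` (for some choice of pairs and radii). The loop runs until no pair of `T` is at least
`γ(k-1)`-node-connected in the region; then the algorithm is called on every carved-out set `A`,
with the pairs of `T` inside `A`. -/
inductive Returns (γ : ℝ) : Finset V → Finset (Fin I.r) → Finset V → Prop
  | intro (U : Finset V) (T : Finset (Fin I.r)) (S : Finset V) (C : Finset (Finset V))
      (Z : Finset V) (Zrec : Finset V → Finset V) :
      I.LoopReaches x y γ U T S C Z →
      (∀ i ∈ T, ¬ I.ConnAtLeast S (I.s i) (I.t i) (γ * ((I.k : ℝ) - 1))) →
      (∀ A ∈ C, Returns γ A (I.pairsIn T A) (Zrec A)) →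
      Returns γ U T (Z ∪ C.biUnion Zrec)

end NodeMulticut

/-- `ln r · ln ln r`, with `r` replaced by `3` for `r ≤ 2`, where `ln ln r` is not positive. -/
noncomputable def lnTimesLnLn (r : ℕ) : ℝ :=
  Real.log (max (r : ℝ) 3) * Real.log (Real.log (max (r : ℝ) 3))

/-!
Node-disjoint `s_i`-`t_i` paths cross the boundary `Γ` of a ball in distinct nodes, so
`|Γ| ≥ γ (k - 1)` at every radius in `[0, 1)`. As `∑ yⁱ ≤ k - 1`, averaging over the radius shows
that `|Γ^y| > √γ (k - 1)` happens only on a set of radii of measure less than `1 / √γ`; elsewhere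
`|Γ^x| ≥ (1 - 1 / √γ) |Γ|`. The volume `W` of the ball grows at rate `|Γ^x|`, hence
`-ln ln (e M / W)`, where `M` is the volume of the region, grows at rate
`|Γ^x| / (W ln (e M / W))`, while its total increase is at most `ln ln (e (r + 1))`. By Markov's
inequality the required bound on `|Γ|` fails only on a small set of radii, and likewise for the
complementary volume. What remains is a good radius.

For the cost, a call on `(U, T)` holds a credit `x(U) + β |T|` that it spends at the price
`ln (vol U / β) + 3 ln (|T| + 1)`. Every iteration separates a pair, whose share `β` pays for the
`β` in `W`; passing to the carved-out part `A` halves the number of pairs and lowers the price from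
`ln (W / β) + 3 ln (|T| + 1)` by at least one, which pays for the boundary.
-/

open MeasureTheory Filter Topology

section MonotoneDerivative

theorem volume_le_deriv_le_of_monotone {g : ℝ → ℝ} (hg : Monotone g) {a b c : ℝ} (hab : a ≤ b)
    (hc : 0 < c) :
    volume {ρ ∈ Set.Ico a b | c ≤ deriv g ρ} ≤ ENNReal.ofReal ((g b - g a) / c) := by
  have hmono : MonotoneOn g (Set.uIcc a b) := hg.monotoneOn _
  have hintegral : ∫ ρ in Set.Ico a b, deriv g ρ ≤ g b - g a := by
    have h := hmono.intervalIntegral_deriv_mem_uIcc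
    rw [Set.uIcc_of_le (sub_nonneg.2 (hg hab)), intervalIntegral.integral_of_le hab,
      ← integral_Ico_eq_integral_Ioc] at h
    exact h.2
  have hintegrable : IntegrableOn (deriv g) (Set.Ico a b) :=
    (intervalIntegrable_iff_integrableOn_Ico_of_le hab).1 hmono.intervalIntegrable_deriv
  have hmarkov := mul_meas_ge_le_integral_of_nonneg (μ := volume.restrict (Set.Ico a b))
    (Eventually.of_forall fun ρ => hg.deriv_nonneg (x := ρ)) hintegrable c
  have hset : volume {ρ ∈ Set.Ico a b | c ≤ deriv g ρ} =
      volume.restrict (Set.Ico a b) {ρ | c ≤ deriv g ρ} := by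
    rw [Measure.restrict_apply (measurableSet_le measurable_const (measurable_deriv g)),
      Set.inter_comm]
    rfl
  rw [hset, ← ENNReal.ofReal_toReal (measure_ne_top (volume.restrict (Set.Ico a b)) _)]
  refine ENNReal.ofReal_le_ofReal ((le_div_iff₀ hc).2 ?_)
  rw [mul_comm]
  exact hmarkov.trans hintegral

theorem volume_le_abs_deriv_le {g : ℝ → ℝ} (hg : Monotone g ∨ Antitone g) {a b c : ℝ}
    (hab : a ≤ b) (hc : 0 < c) :
    volume {ρ ∈ Set.Ico a b | c ≤ |deriv g ρ|} ≤ ENNReal.ofReal (|g b - g a| / c) := by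
  rcases hg with hg | hg
  · simpa only [abs_of_nonneg hg.deriv_nonneg, abs_of_nonneg (sub_nonneg.2 (hg hab))] using
      volume_le_deriv_le_of_monotone hg hab hc
  · have h := volume_le_deriv_le_of_monotone hg.neg hab hc
    simpa only [deriv.fun_neg, Pi.neg_apply, abs_of_nonpos hg.deriv_nonpos,
      abs_of_nonpos (sub_nonpos.2 (hg hab)), neg_sub, neg_sub_neg] using h

theorem le_deriv_of_eventually_right {W : ℝ → ℝ} {a ρ : ℝ} (hd : DifferentiableAt ℝ W ρ)
    (h : ∀ᶠ ρ' in 𝓝[>] ρ, W ρ + a * (ρ' - ρ) ≤ W ρ') : a ≤ deriv W ρ := by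
  have hslope : Tendsto (slope W ρ) (𝓝[>] ρ) (𝓝 (deriv W ρ)) :=
    (hasDerivAt_iff_tendsto_slope.1 hd.hasDerivAt).mono_left
      (nhdsWithin_mono _ fun z (hz : ρ < z) => hz.ne')
  refine ge_of_tendsto hslope ?_
  filter_upwards [h, self_mem_nhdsWithin] with z hz (hlt : ρ < z)
  rw [slope_def_field, le_div_iff₀ (sub_pos.2 hlt)]
  linarith

end MonotoneDerivative

section VolLog

variable {m M w : ℝ}

/-- The bound `w ln(e M / w)` of the region-growing inequality for a region of volume `w` out of a
total volume `M`. -/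
noncomputable def volLog (M w : ℝ) : ℝ := w * Real.log (Real.exp 1 * M / w)

/-- An antiderivative of `w ↦ 1 / (w ln(e M / w))` on `(0, M]`; it has the total increase
`ln ln(e M / m)` on `[m, M]`. -/
noncomputable def logLogPotential (M w : ℝ) : ℝ := -Real.log (Real.log (Real.exp 1 * M / w))

theorem log_exp_one_mul_div (hw : 0 < w) (hM : 0 < M) :
    Real.log (Real.exp 1 * M / w) = 1 + Real.log M - Real.log w := by
  rw [Real.log_div (by positivity) hw.ne', Real.log_mul (Real.exp_pos 1).ne' hM.ne', Real.log_exp]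

theorem one_le_log_exp_one_mul_div (hw : 0 < w) (hwM : w ≤ M) :
    1 ≤ Real.log (Real.exp 1 * M / w) := by
  rw [log_exp_one_mul_div hw (hw.trans_le hwM)]
  linarith [Real.log_le_log hw hwM]

theorem volLog_pos (hw : 0 < w) (hwM : w ≤ M) : 0 < volLog M w :=
  mul_pos hw (one_pos.trans_le (one_le_log_exp_one_mul_div hw hwM))

theorem volLog_monotoneOn : MonotoneOn (volLog M) (Set.Ioc 0 M) := by
  rintro w ⟨hw, -⟩ w' ⟨hw', hM⟩ h
  have hM0 := hw'.trans_le hM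
  rw [volLog, volLog, log_exp_one_mul_div hw hM0, log_exp_one_mul_div hw' hM0]
  have hlogM : Real.log w' ≤ Real.log M := Real.log_le_log hw' hM
  have hlog : w * (Real.log w' - Real.log w) ≤ w' - w := by
    rw [← Real.log_div hw'.ne' hw.ne']
    calc w * Real.log (w' / w) ≤ w * (w' / w - 1) := by
          gcongr
          exact Real.log_le_sub_one_of_pos (div_pos hw' hw)
      _ = w' - w := by field_simp
  nlinarith [mul_nonneg (sub_nonneg.2 h) (sub_nonneg.2 hlogM)]

theorem logLogPotential_monotoneOn : MonotoneOn (logLogPotential M) (Set.Ioc 0 M) := by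
  rintro w ⟨hw, -⟩ w' ⟨hw', hM⟩ h
  refine neg_le_neg (Real.log_le_log (one_pos.trans_le (one_le_log_exp_one_mul_div hw' hM)) ?_)
  have hM0 := hw'.trans_le hM
  gcongr

theorem hasDerivAt_logLogPotential (hw : 0 < w) (hwM : w ≤ M) :
    HasDerivAt (logLogPotential M) (volLog M w)⁻¹ w := by
  have hM := hw.trans_le hwM
  have hlog := one_pos.trans_le (one_le_log_exp_one_mul_div hw hwM)
  have hinner : HasDerivAt (fun w => Real.log (Real.exp 1 * M / w)) (-w⁻¹) w := by
    refine ((Real.hasDerivAt_log hw.ne').const_sub (1 + Real.log M)).congr_of_eventuallyEq ?_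
    filter_upwards [lt_mem_nhds hw] with v hv using log_exp_one_mul_div hv hM
  refine (hinner.log hlog.ne').neg.congr_deriv ?_
  rw [volLog, mul_inv, neg_div, neg_neg, div_eq_mul_inv]

theorem abs_logLogPotential_sub_le {w' : ℝ} (hm : 0 < m) (hw : w ∈ Set.Icc m M)
    (hw' : w' ∈ Set.Icc m M) :
    |logLogPotential M w' - logLogPotential M w| ≤ Real.log (Real.log (Real.exp 1 * M / m)) := by
  have hrange : ∀ v ∈ Set.Icc m M, logLogPotential M m ≤ logLogPotential M v ∧
      logLogPotential M v ≤ 0 := fun v hv =>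
    have hv0 := hm.trans_le hv.1
    ⟨logLogPotential_monotoneOn ⟨hm, hv.1.trans hv.2⟩ ⟨hv0, hv.2⟩ hv.1,
      neg_nonpos.2 (Real.log_nonneg (one_le_log_exp_one_mul_div hv0 hv.2))⟩
  obtain ⟨hlow, hhigh⟩ := hrange w hw
  obtain ⟨hlow', hhigh'⟩ := hrange w' hw'
  unfold logLogPotential at *
  rw [abs_le]
  constructor <;> linarith

end VolLog

section RadiusSelection

variable {m M a b c : ℝ}

theorem volume_volLog_lt_le {W n : ℝ → ℝ} (hm : 0 < m) (hc : 0 < c) (hab : a ≤ b)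
    (hW : ∀ ρ, W ρ ∈ Set.Icc m M) (hmono : Monotone W ∨ Antitone W)
    (hn : ∀ᵐ ρ, n ρ ≤ |deriv W ρ|) :
    volume {ρ ∈ Set.Ico a b | c * volLog M (W ρ) < n ρ} ≤
      ENNReal.ofReal (Real.log (Real.log (Real.exp 1 * M / m)) / c) := by
  have hpos : ∀ ρ, 0 < W ρ := fun ρ => hm.trans_le (hW ρ).1
  have hmem : ∀ ρ, W ρ ∈ Set.Ioc 0 M := fun ρ => ⟨hpos ρ, (hW ρ).2⟩
  have hcomp : Monotone (logLogPotential M ∘ W) ∨ Antitone (logLogPotential M ∘ W) :=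
    hmono.imp (fun h _ _ hle => logLogPotential_monotoneOn (hmem _) (hmem _) (h hle))
      fun h _ _ hle => logLogPotential_monotoneOn (hmem _) (hmem _) (h hle)
  have hdiff : ∀ᵐ ρ, DifferentiableAt ℝ W ρ := by
    rcases hmono with h | h
    · exact h.ae_differentiableAt
    · filter_upwards [h.neg.ae_differentiableAt] with ρ hρ
      exact differentiableAt_neg_iff.1 hρ
  have hlarge : ∀ᵐ ρ, ρ ∈ {ρ ∈ Set.Ico a b | c * volLog M (W ρ) < n ρ} →
      ρ ∈ {ρ ∈ Set.Ico a b | c ≤ |deriv (logLogPotential M ∘ W) ρ|} := by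
    filter_upwards [hdiff, hn] with ρ hd hρ ⟨hI, hlt⟩
    have hvol := volLog_pos (hpos ρ) (hW ρ).2
    refine ⟨hI, ?_⟩
    rw [((hasDerivAt_logLogPotential (hpos ρ) (hW ρ).2).comp ρ hd.hasDerivAt).deriv, abs_mul,
      abs_inv, abs_of_pos hvol, inv_mul_eq_div, le_div_iff₀ hvol]
    exact hlt.le.trans hρ
  refine (measure_mono_ae hlarge).trans ((volume_le_abs_deriv_le hcomp hab hc).trans ?_)
  gcongr
  exact abs_logLogPotential_sub_le hm (hW a) (hW b)

theorem exists_radius_le_volLog {V n : ℝ → ℝ} {E : Set ℝ} (hm : 0 < m) (hc : 0 < c)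
    (hab : a ≤ b) (hV : ∀ ρ, V ρ ∈ Set.Icc m M) (hmono : Monotone V)
    (hgrowth : ∀ ρ, ∀ᶠ ρ' in 𝓝[>] ρ, V ρ + n ρ * (ρ' - ρ) ≤ V ρ')
    (hE : volume E <
      ENNReal.ofReal (b - a - 2 * (Real.log (Real.log (Real.exp 1 * M / m)) / c))) :
    ∃ ρ ∈ Set.Ico a b, ρ ∉ E ∧ n ρ ≤ c * volLog M (V ρ) ∧ n ρ ≤ c * volLog M (m + M - V ρ) := by
  set δ := Real.log (Real.log (Real.exp 1 * M / m)) / c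
  have hδ : 0 ≤ δ :=
    div_nonneg (Real.log_nonneg (one_le_log_exp_one_mul_div hm ((hV a).1.trans (hV a).2))) hc.le
  have hn : ∀ᵐ ρ, n ρ ≤ deriv V ρ := by
    filter_upwards [hmono.ae_differentiableAt] with ρ hd
    exact le_deriv_of_eventually_right hd (hgrowth ρ)
  let fast (W : ℝ → ℝ) : Set ℝ := {ρ ∈ Set.Ico a b | c * volLog M (W ρ) < n ρ}
  have hfast : volume (fast V) ≤ ENNReal.ofReal δ :=
    volume_volLog_lt_le hm hc hab hV (.inl hmono) (hn.mono fun ρ h => h.trans (le_abs_self _))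
  have hfast' : volume (fast fun ρ => m + M - V ρ) ≤ ENNReal.ofReal δ :=
    volume_volLog_lt_le hm hc hab
      (fun ρ => ⟨by linarith [(hV ρ).2], by linarith [(hV ρ).1]⟩)
      (.inr fun _ _ h => sub_le_sub_left (hmono h) _)
      (hn.mono fun ρ h => by rw [deriv_const_sub, abs_neg]; exact h.trans (le_abs_self _))
  have hsmall : volume (E ∪ (fast V ∪ fast fun ρ => m + M - V ρ)) < volume (Set.Ico a b) := by
    have hpos : 0 < b - a - 2 * δ := ENNReal.ofReal_pos.1 (pos_of_gt hE)
    calc volume (E ∪ (fast V ∪ fast fun ρ => m + M - V ρ))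
        ≤ volume E + (volume (fast V) + volume (fast fun ρ => m + M - V ρ)) :=
          (measure_union_le _ _).trans (by gcongr; exact measure_union_le _ _)
      _ ≤ volume E + (ENNReal.ofReal δ + ENNReal.ofReal δ) := by gcongr
      _ < ENNReal.ofReal (b - a - 2 * δ) + (ENNReal.ofReal δ + ENNReal.ofReal δ) :=
          ENNReal.add_lt_add_right (by finiteness) hE
      _ = volume (Set.Ico a b) := by
          rw [← ENNReal.ofReal_add hδ hδ, ← ENNReal.ofReal_add hpos.le (by positivity),
            Real.volume_Ico]
          ring_nf
  obtain ⟨ρ, hρ, hout⟩ := Set.not_subset.1 fun hsub => (measure_mono hsub).not_gt hsmall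
  simp only [fast, Set.mem_union, Set.mem_ofPred_eq, not_or, hρ, true_and, not_lt] at hout
  exact ⟨ρ, hρ, hout⟩

theorem meas_card_ge_le {α ι : Type*} [MeasurableSpace α] (μ : Measure α) (s : Finset ι)
    {A : ι → Set α} [∀ ω, DecidablePred fun j => ω ∈ A j] (hA : ∀ j ∈ s, MeasurableSet (A j))
    {q : ℕ} (hq : q ≠ 0) :
    μ {ω | q ≤ (s.filter fun j => ω ∈ A j).card} ≤ (∑ j ∈ s, μ (A j)) / q := by
  have hcount : ∀ ω, ∑ j ∈ s, (A j).indicator (1 : α → ENNReal) ω =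
      (s.filter fun j => ω ∈ A j).card := fun ω => by
    simp only [Finset.card_filter, Nat.cast_sum, Set.indicator_apply, Pi.one_apply, Nat.cast_ite,
      Nat.cast_one, Nat.cast_zero]
  have hmeas : ∀ j ∈ s, Measurable ((A j).indicator (1 : α → ENNReal)) :=
    fun j hj => measurable_one.indicator (hA j hj)
  have hmarkov := mul_meas_ge_le_lintegral (μ := μ) (Finset.measurable_fun_sum s hmeas) q
  rw [lintegral_finsetSum' _ fun j hj => (hmeas j hj).aemeasurable,
    Finset.sum_congr rfl fun j hj => lintegral_indicator_one (hA j hj)] at hmarkov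
  simp only [hcount, Nat.cast_le] at hmarkov
  rwa [ENNReal.le_div_iff_mul_le (by simp [hq]) (by simp), mul_comm]

end RadiusSelection

namespace NodeMulticut

section Distance

variable {V : Type u} {I : NodeMulticut V} {x : V → ℝ} {y : Fin I.r → V → ℝ} {i : Fin I.r}

theorem ell_le_walk (hw : ∀ v, 0 ≤ x v + y i v) {a b : V} (p : I.graph.Walk a b) :
    I.ell x y i a b ≤ (p.support.tail.map fun w => x w + y i w).sum := by
  classical
  have hnonneg : ∀ (l : List V), ∀ c ∈ l.map fun w => x w + y i w, 0 ≤ c := fun l c hc => by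
    obtain ⟨w, -, rfl⟩ := List.mem_map.1 hc
    exact hw w
  have hbypass : p.bypass.support.tail.Sublist p.support.tail := by
    have h := p.support_bypass_sublist_support
    rw [← p.cons_tail_support, ← p.bypass.cons_tail_support] at h
    exact List.cons_sublist_cons.1 h
  calc I.ell x y i a b ≤ (p.bypass.support.tail.map fun w => x w + y i w).sum :=
        ciInf_le ⟨0, by rintro _ ⟨q, rfl⟩; exact List.sum_nonneg (hnonneg _)⟩ p.toPath
    _ ≤ (p.support.tail.map fun w => x w + y i w).sum :=
        (hbypass.map _).sum_le_sum (hnonneg _)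

theorem ell_self_le_zero (hw : ∀ v, 0 ≤ x v + y i v) (a : V) : I.ell x y i a a ≤ 0 := by
  simpa using ell_le_walk hw (SimpleGraph.Walk.nil : I.graph.Walk a a)

theorem ell_le_of_adj (hw : ∀ v, 0 ≤ x v + y i v) {a w v : V} (hr : I.graph.Reachable a w)
    (hadj : I.graph.Adj w v) : I.ell x y i a v ≤ I.ell x y i a w + (x v + y i v) := by
  classical
  have : Nonempty (I.graph.Path a w) := ⟨hr.some.toPath⟩
  rw [← sub_le_iff_le_add]
  refine le_ciInf fun p => ?_
  rw [sub_le_iff_le_add]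
  refine (ell_le_walk hw (p.1.concat hadj)).trans_eq ?_
  rw [SimpleGraph.Walk.support_concat, List.tail_append_of_ne_nil p.1.support_ne_nil]
  simp

theorem LPFeasible.weight_nonneg [Fintype V] (h : I.LPFeasible x y) (i : Fin I.r) (v : V) :
    0 ≤ x v + y i v :=
  add_nonneg (h.x_nonneg v) (h.y_nonneg i v)

theorem LPFeasible.one_le_ell [Fintype V] (h : I.LPFeasible x y)
    (hr : I.graph.Reachable (I.s i) (I.t i)) : 1 ≤ I.ell x y i (I.s i) (I.t i) := by
  classical
  have : Nonempty (I.graph.Path (I.s i) (I.t i)) := ⟨hr.some.toPath⟩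
  refine le_ciInf fun p => ?_
  have hp := h.path i p
  rw [← p.1.cons_tail_support, List.map_cons, List.sum_cons,
    h.x_terminal _ ⟨i, .inl rfl⟩, h.y_source i] at hp
  linarith

end Distance

section Region

variable {V : Type u} {I : NodeMulticut V} [Fintype V] [DecidableEq V] {x : V → ℝ}
  {y : Fin I.r → V → ℝ} {S : Finset V} {i : Fin I.r} {z v : V} {ρ ρ' : ℝ}

theorem mem_ball : v ∈ I.ball x y S i z ρ ↔
    v ∈ S ∧ I.graph.Reachable z v ∧ I.ell x y i z v ≤ ρ := by
  simp [ball]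

theorem mem_bdry : v ∈ I.bdry x y S i z ρ ↔
    (v ∈ S ∧ v ∉ I.ball x y S i z ρ) ∧ ∃ w ∈ I.ball x y S i z ρ, I.graph.Adj w v := by
  simp [bdry]

theorem mem_coBall : v ∈ I.coBall x y S i z ρ ↔
    v ∈ S ∧ v ∉ I.ball x y S i z ρ ∧ v ∉ I.bdry x y S i z ρ := by
  simp [coBall]

theorem mem_xBdry : v ∈ I.xBdry x y S i z ρ ↔ v ∈ I.bdry x y S i z ρ ∧
    ρ + y i v < I.ell x y i z v ∧ I.ell x y i z v ≤ ρ + x v + y i v := by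
  simp [xBdry]

theorem mem_yBdry : v ∈ I.yBdry x y S i z ρ ↔ v ∈ I.bdry x y S i z ρ ∧
    ρ < I.ell x y i z v ∧ I.ell x y i z v ≤ ρ + y i v := by
  simp [yBdry]

theorem ball_subset : I.ball x y S i z ρ ⊆ S := fun _ hv => (mem_ball.1 hv).1

theorem bdry_subset : I.bdry x y S i z ρ ⊆ S := fun _ hv => (mem_bdry.1 hv).1.1

theorem coBall_subset : I.coBall x y S i z ρ ⊆ S := fun _ hv => (mem_coBall.1 hv).1

theorem xBdry_subset : I.xBdry x y S i z ρ ⊆ I.bdry x y S i z ρ := fun _ hv => (mem_xBdry.1 hv).1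

theorem yBdry_subset : I.yBdry x y S i z ρ ⊆ I.bdry x y S i z ρ := fun _ hv => (mem_yBdry.1 hv).1

theorem disjoint_ball_bdry : Disjoint (I.ball x y S i z ρ) (I.bdry x y S i z ρ) :=
  Finset.disjoint_left.2 fun _ hv h => (mem_bdry.1 h).1.2 hv

theorem disjoint_coBall_ball : Disjoint (I.coBall x y S i z ρ) (I.ball x y S i z ρ) :=
  Finset.disjoint_left.2 fun _ hv h => (mem_coBall.1 hv).2.1 h

theorem disjoint_coBall_bdry : Disjoint (I.coBall x y S i z ρ) (I.bdry x y S i z ρ) :=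
  Finset.disjoint_left.2 fun _ hv h => (mem_coBall.1 hv).2.2 h

theorem disjoint_xBdry_yBdry : Disjoint (I.xBdry x y S i z ρ) (I.yBdry x y S i z ρ) :=
  Finset.disjoint_left.2 fun _ hv h => (mem_xBdry.1 hv).2.1.not_ge (mem_yBdry.1 h).2.2

theorem ball_mono (h : ρ ≤ ρ') : I.ball x y S i z ρ ⊆ I.ball x y S i z ρ' := fun _ hv =>
  have ⟨hS, hr, hle⟩ := mem_ball.1 hv
  mem_ball.2 ⟨hS, hr, hle.trans h⟩

theorem ball_union_bdry_mono (h : ρ ≤ ρ') : I.ball x y S i z ρ ∪ I.bdry x y S i z ρ ⊆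
    I.ball x y S i z ρ' ∪ I.bdry x y S i z ρ' := by
  intro v hv
  rw [Finset.mem_union] at hv ⊢
  rcases hv with hv | hv
  · exact .inl (ball_mono h hv)
  · obtain ⟨⟨hS, -⟩, w, hw, hadj⟩ := mem_bdry.1 hv
    exact or_iff_not_imp_left.2 fun hb => mem_bdry.2 ⟨⟨hS, hb⟩, w, ball_mono h hw, hadj⟩

theorem lt_ell_of_mem_bdry (hv : v ∈ I.bdry x y S i z ρ) : ρ < I.ell x y i z v := by
  obtain ⟨⟨hS, hb⟩, w, hw, hadj⟩ := mem_bdry.1 hv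
  exact not_le.1 fun hle => hb (mem_ball.2 ⟨hS, (mem_ball.1 hw).2.1.trans hadj.reachable, hle⟩)

theorem ell_le_of_mem_bdry (hw : ∀ v, 0 ≤ x v + y i v) (hv : v ∈ I.bdry x y S i z ρ) :
    I.ell x y i z v ≤ ρ + x v + y i v := by
  obtain ⟨-, w, hwb, hadj⟩ := mem_bdry.1 hv
  obtain ⟨-, hr, hle⟩ := mem_ball.1 hwb
  linarith [ell_le_of_adj hw hr hadj]

theorem bdry_eq_union (hw : ∀ v, 0 ≤ x v + y i v) :
    I.bdry x y S i z ρ = I.xBdry x y S i z ρ ∪ I.yBdry x y S i z ρ := by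
  ext v
  rw [Finset.mem_union, mem_xBdry, mem_yBdry]
  refine ⟨fun hv => ?_, fun hv => hv.elim And.left And.left⟩
  rcases lt_or_ge (ρ + y i v) (I.ell x y i z v) with h | h
  · exact .inl ⟨hv, h, ell_le_of_mem_bdry hw hv⟩
  · exact .inr ⟨hv, lt_ell_of_mem_bdry hv, h⟩

theorem card_bdry (hw : ∀ v, 0 ≤ x v + y i v) :
    (I.bdry x y S i z ρ).card = (I.xBdry x y S i z ρ).card + (I.yBdry x y S i z ρ).card := by
  rw [bdry_eq_union hw, Finset.card_union_of_disjoint disjoint_xBdry_yBdry]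

theorem sum_region (hw : ∀ v, 0 ≤ x v + y i v) (S : Finset V) (z : V) (ρ : ℝ) (f : V → ℝ) :
    ∑ v ∈ S, f v = ∑ v ∈ I.ball x y S i z ρ, f v + ∑ v ∈ I.xBdry x y S i z ρ, f v
      + ∑ v ∈ I.yBdry x y S i z ρ, f v + ∑ v ∈ I.coBall x y S i z ρ, f v := by
  have hsub : I.ball x y S i z ρ ∪ I.bdry x y S i z ρ ⊆ S :=
    Finset.union_subset ball_subset bdry_subset
  rw [← Finset.sum_sdiff hsub, Finset.sum_union disjoint_ball_bdry, bdry_eq_union hw,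
    Finset.sum_union disjoint_xBdry_yBdry, coBall, bdry_eq_union hw]
  ring

end Region

section Volume

variable {V : Type u} {I : NodeMulticut V} [Fintype V] {x : V → ℝ} {y : Fin I.r → V → ℝ}
  {S : Finset V} {i : Fin I.r} {z v : V} {ρ : ℝ}

theorem beta_le_regionVol (hx : ∀ v, 0 ≤ x v) : I.beta x ≤ I.regionVol x S :=
  le_add_of_nonneg_right (Finset.sum_nonneg fun v _ => hx v)

theorem beta_nonneg (hx : ∀ v, 0 ≤ x v) : 0 ≤ I.beta x :=
  div_nonneg (Finset.sum_nonneg fun v _ => hx v) (Nat.cast_nonneg _)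

theorem beta_mul_r_le (hx : ∀ v, 0 ≤ x v) : I.beta x * I.r ≤ ∑ v, x v := by
  rcases I.r.eq_zero_or_pos with hr | hr
  · simpa [hr] using Finset.sum_nonneg fun v _ => hx v
  · exact (div_mul_cancel₀ _ (Nat.cast_ne_zero.2 hr.ne')).le

theorem regionVol_div_beta_le (hx : ∀ v, 0 ≤ x v) : I.regionVol x S / I.beta x ≤ I.r + 1 := by
  rcases I.r.eq_zero_or_pos with hr | hr
  · simp [beta, hr]
  refine div_le_of_le_mul₀ (beta_nonneg hx) (by positivity) ?_
  have hβ : I.beta x * I.r = ∑ v, x v := div_mul_cancel₀ _ (Nat.cast_ne_zero.2 hr.ne')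
  have hS : ∑ v ∈ S, x v ≤ ∑ v, x v :=
    Finset.sum_le_sum_of_subset_of_nonneg (Finset.subset_univ S) fun v _ _ => hx v
  rw [regionVol]
  linarith

variable [DecidableEq V]

theorem ballVol_eq : I.ballVol x y S i z ρ = I.beta x + ∑ v ∈ I.ball x y S i z ρ, x v
    + ∑ v ∈ I.yBdry x y S i z ρ, x v
    + ∑ v ∈ I.xBdry x y S i z ρ, (ρ - (I.ell x y i z v - x v - y i v)) := by
  rw [ballVol, Finset.sum_union (disjoint_ball_bdry.mono_right yBdry_subset)]
  ring

theorem coBallVol_eq : I.coBallVol x y S i z ρ = I.beta x + ∑ v ∈ I.coBall x y S i z ρ, x v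
    + ∑ v ∈ I.yBdry x y S i z ρ, x v
    + ∑ v ∈ I.xBdry x y S i z ρ, (I.ell x y i z v - y i v - ρ) := by
  rw [coBallVol, Finset.sum_union (disjoint_coBall_bdry.mono_right yBdry_subset)]
  ring

theorem ballVol_add_coBallVol (hw : ∀ v, 0 ≤ x v + y i v) (S : Finset V) (z : V) (ρ : ℝ) :
    I.ballVol x y S i z ρ + I.coBallVol x y S i z ρ =
      I.beta x + I.regionVol x S + ∑ v ∈ I.yBdry x y S i z ρ, x v := by
  have hxBdry : ∑ v ∈ I.xBdry x y S i z ρ, x v =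
      ∑ v ∈ I.xBdry x y S i z ρ, (ρ - (I.ell x y i z v - x v - y i v)) +
        ∑ v ∈ I.xBdry x y S i z ρ, (I.ell x y i z v - y i v - ρ) := by
    rw [← Finset.sum_add_distrib]
    exact Finset.sum_congr rfl fun v _ => by ring
  rw [ballVol_eq, coBallVol_eq, regionVol, sum_region hw S z ρ, hxBdry]
  ring

theorem ballVol_add_sum_coBall_le (hw : ∀ v, 0 ≤ x v + y i v) (S : Finset V) (z : V) (ρ : ℝ) :
    I.ballVol x y S i z ρ + ∑ v ∈ I.coBall x y S i z ρ, x v ≤ I.regionVol x S := by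
  have hxBdry : ∑ v ∈ I.xBdry x y S i z ρ, (ρ - (I.ell x y i z v - x v - y i v)) ≤
      ∑ v ∈ I.xBdry x y S i z ρ, x v :=
    Finset.sum_le_sum fun v hv => by linarith [(mem_xBdry.1 hv).2.1]
  rw [ballVol_eq, regionVol, sum_region hw S z ρ]
  linarith

theorem coBallVol_add_sum_ball_le (hw : ∀ v, 0 ≤ x v + y i v) (S : Finset V) (z : V) (ρ : ℝ) :
    I.coBallVol x y S i z ρ + ∑ v ∈ I.ball x y S i z ρ, x v ≤ I.regionVol x S := by
  have hxBdry : ∑ v ∈ I.xBdry x y S i z ρ, (I.ell x y i z v - y i v - ρ) ≤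
      ∑ v ∈ I.xBdry x y S i z ρ, x v :=
    Finset.sum_le_sum fun v hv => by linarith [(mem_xBdry.1 hv).2.2]
  rw [coBallVol_eq, regionVol, sum_region hw S z ρ]
  linarith

theorem regionVol_ball_le (hx : ∀ v, 0 ≤ x v) :
    I.regionVol x (I.ball x y S i z ρ) ≤ I.ballVol x y S i z ρ := by
  have hxBdry : 0 ≤ ∑ v ∈ I.xBdry x y S i z ρ, (ρ - (I.ell x y i z v - x v - y i v)) :=
    Finset.sum_nonneg fun v hv => by linarith [(mem_xBdry.1 hv).2.2]
  rw [ballVol_eq, regionVol]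
  linarith [Finset.sum_nonneg fun v (_ : v ∈ I.yBdry x y S i z ρ) => hx v]

theorem regionVol_coBall_le (hx : ∀ v, 0 ≤ x v) :
    I.regionVol x (I.coBall x y S i z ρ) ≤ I.coBallVol x y S i z ρ := by
  have hxBdry : 0 ≤ ∑ v ∈ I.xBdry x y S i z ρ, (I.ell x y i z v - y i v - ρ) :=
    Finset.sum_nonneg fun v hv => by linarith [(mem_xBdry.1 hv).2.1]
  rw [coBallVol_eq, regionVol]
  linarith [Finset.sum_nonneg fun v (_ : v ∈ I.yBdry x y S i z ρ) => hx v]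

theorem ballVol_mem_Icc (hx : ∀ v, 0 ≤ x v) (hw : ∀ v, 0 ≤ x v + y i v) (S : Finset V) (z : V)
    (ρ : ℝ) : I.ballVol x y S i z ρ ∈ Set.Icc (I.beta x) (I.regionVol x S) :=
  ⟨(beta_le_regionVol hx).trans (regionVol_ball_le hx),
    (le_add_of_nonneg_right (Finset.sum_nonneg fun v _ => hx v)).trans
      (ballVol_add_sum_coBall_le hw S z ρ)⟩

theorem coBallVol_mem_Icc (hx : ∀ v, 0 ≤ x v) (hw : ∀ v, 0 ≤ x v + y i v) (S : Finset V) (z : V)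
    (ρ : ℝ) : I.coBallVol x y S i z ρ ∈ Set.Icc (I.beta x) (I.regionVol x S) :=
  ⟨(beta_le_regionVol hx).trans (regionVol_coBall_le hx),
    (le_add_of_nonneg_right (Finset.sum_nonneg fun v _ => hx v)).trans
      (coBallVol_add_sum_ball_le hw S z ρ)⟩

variable (I x y S i z) in
/-- The contribution of the node `v` to the volume of the ball of radius `ρ`, as a function of
`ρ`: it grows from `0` to `x v` while the ball absorbs `v`. -/
noncomputable def absorbed (v : V) (ρ : ℝ) : ℝ :=
  if v ∈ I.ball x y S i z ρ ∪ I.bdry x y S i z ρ then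
    min (x v) (ρ - (I.ell x y i z v - x v - y i v)) else 0

theorem absorbed_nonneg (hx : ∀ v, 0 ≤ x v) (hy : ∀ v, 0 ≤ y i v) :
    0 ≤ I.absorbed x y S i z v ρ := by
  rw [absorbed]
  split_ifs with hv
  · refine le_min (hx v) ?_
    rcases Finset.mem_union.1 hv with hb | hb
    · linarith [(mem_ball.1 hb).2.2, hx v, hy v]
    · linarith [ell_le_of_mem_bdry (fun v => add_nonneg (hx v) (hy v)) hb]
  · exact le_rfl

theorem absorbed_mono (hx : ∀ v, 0 ≤ x v) (hy : ∀ v, 0 ≤ y i v) (v : V) :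
    Monotone (I.absorbed x y S i z v) := by
  intro ρ ρ' h
  by_cases hv : v ∈ I.ball x y S i z ρ ∪ I.bdry x y S i z ρ
  · rw [absorbed, absorbed, if_pos hv, if_pos (ball_union_bdry_mono h hv)]
    gcongr
  · rw [absorbed, if_neg hv]
    exact absorbed_nonneg hx hy

theorem absorbed_of_mem_ball (hy : ∀ v, 0 ≤ y i v) (hv : v ∈ I.ball x y S i z ρ) :
    I.absorbed x y S i z v ρ = x v := by
  rw [absorbed, if_pos (Finset.mem_union_left _ hv), min_eq_left]
  linarith [(mem_ball.1 hv).2.2, hy v]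

theorem absorbed_of_mem_yBdry (hv : v ∈ I.yBdry x y S i z ρ) :
    I.absorbed x y S i z v ρ = x v := by
  rw [absorbed, if_pos (Finset.mem_union_right _ (yBdry_subset hv)), min_eq_left]
  linarith [(mem_yBdry.1 hv).2.2]

theorem absorbed_of_mem_xBdry (hv : v ∈ I.xBdry x y S i z ρ) :
    I.absorbed x y S i z v ρ = ρ - (I.ell x y i z v - x v - y i v) := by
  rw [absorbed, if_pos (Finset.mem_union_right _ (xBdry_subset hv)), min_eq_right]
  linarith [(mem_xBdry.1 hv).2.1]

theorem absorbed_of_mem_coBall (hv : v ∈ I.coBall x y S i z ρ) :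
    I.absorbed x y S i z v ρ = 0 := by
  rw [absorbed, if_neg]
  rw [Finset.mem_union]
  exact not_or.2 (mem_coBall.1 hv).2

theorem ballVol_eq_sum_absorbed (hx : ∀ v, 0 ≤ x v) (hy : ∀ v, 0 ≤ y i v) :
    I.ballVol x y S i z ρ = I.beta x + ∑ v ∈ S, I.absorbed x y S i z v ρ := by
  rw [ballVol_eq, sum_region (fun v => add_nonneg (hx v) (hy v)) S z ρ,
    Finset.sum_congr rfl fun v hv => absorbed_of_mem_ball hy hv,
    Finset.sum_congr rfl fun v hv => absorbed_of_mem_yBdry hv,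
    Finset.sum_congr rfl fun v hv => absorbed_of_mem_xBdry hv,
    Finset.sum_eq_zero fun v hv => absorbed_of_mem_coBall hv]
  ring

theorem ballVol_mono (hx : ∀ v, 0 ≤ x v) (hy : ∀ v, 0 ≤ y i v) :
    Monotone (I.ballVol x y S i z) := by
  intro ρ ρ' h
  rw [ballVol_eq_sum_absorbed hx hy, ballVol_eq_sum_absorbed hx hy]
  gcongr with v
  exact absorbed_mono hx hy v h

theorem absorbed_growth (hv : v ∈ I.xBdry x y S i z ρ) :
    ∀ᶠ ρ' in 𝓝[>] ρ, I.absorbed x y S i z v ρ + (ρ' - ρ) ≤ I.absorbed x y S i z v ρ' := by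
  have hlt : ρ < I.ell x y i z v - y i v := by linarith [(mem_xBdry.1 hv).2.1]
  filter_upwards [nhdsWithin_le_nhds (eventually_lt_nhds hlt), self_mem_nhdsWithin]
    with ρ' hρ' (hρ : ρ < ρ')
  rw [absorbed_of_mem_xBdry hv, absorbed,
    if_pos (ball_union_bdry_mono hρ.le (Finset.mem_union_right _ (xBdry_subset hv)))]
  exact le_min (by linarith) (by linarith)

theorem ballVol_growth (hx : ∀ v, 0 ≤ x v) (hy : ∀ v, 0 ≤ y i v) (ρ : ℝ) :
    ∀ᶠ ρ' in 𝓝[>] ρ, I.ballVol x y S i z ρ + (I.xBdry x y S i z ρ).card * (ρ' - ρ) ≤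
      I.ballVol x y S i z ρ' := by
  have hsub : I.xBdry x y S i z ρ ⊆ S := xBdry_subset.trans bdry_subset
  have hev : ∀ᶠ ρ' in 𝓝[>] ρ, ∀ v ∈ I.xBdry x y S i z ρ,
      I.absorbed x y S i z v ρ + (ρ' - ρ) ≤ I.absorbed x y S i z v ρ' :=
    (Finset.eventually_all _).2 fun _ hv => absorbed_growth hv
  filter_upwards [hev, self_mem_nhdsWithin] with ρ' hgrow (hρ : ρ < ρ')
  rw [ballVol_eq_sum_absorbed hx hy, ballVol_eq_sum_absorbed hx hy, add_assoc,
    ← Finset.sum_sdiff hsub, ← Finset.sum_sdiff hsub, add_assoc, ← nsmul_eq_mul,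
    ← Finset.sum_const, ← Finset.sum_add_distrib]
  gcongr with v _ v hv
  · exact absorbed_mono hx hy v hρ.le
  · exact hgrow v hv

end Volume

section GoodRadius

variable {V : Type u} {I : NodeMulticut V} {x : V → ℝ} {y : Fin I.r → V → ℝ} {S : Finset V}
  {i : Fin I.r} {z : V} {ρ c γ : ℝ}

theorem ConnAtLeast.ends_mem {a b : V} (h : I.ConnAtLeast S a b c) (hc : 0 < c) :
    a ∈ S ∧ b ∈ S ∧ I.graph.Reachable a b := by
  obtain ⟨P, hP, hcard⟩ := h
  obtain ⟨p, hp⟩ := Finset.card_pos.1 (Nat.cast_pos.1 (hc.trans_le hcard))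
  exact ⟨hP.1 p hp _ p.1.start_mem_support, hP.1 p hp _ p.1.end_mem_support, p.1.reachable⟩

theorem k_sub_one_pos (hk : 2 ≤ I.k) : (0 : ℝ) < I.k - 1 := sub_pos.2 (Nat.one_lt_cast.2 hk)

variable (I) in
/-- The factor of `W * log (e * regionVol S / W)` in the bound that a good radius satisfies. -/
noncomputable def rate (γ : ℝ) : ℝ :=
  2 * γ / (√γ - 1) ^ 2 * Real.log (Real.log (Real.exp 1 * ((I.r : ℝ) + 1)))

theorem log_log_exp_one_mul_nonneg (r : ℕ) :
    0 ≤ Real.log (Real.log (Real.exp 1 * ((r : ℝ) + 1))) := by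
  have h := one_le_log_exp_one_mul_div one_pos (show (1 : ℝ) ≤ r + 1 by simp)
  rw [div_one] at h
  exact Real.log_nonneg h

theorem log_log_exp_one_mul_pos {r : ℕ} (hr : 0 < r) :
    0 < Real.log (Real.log (Real.exp 1 * ((r : ℝ) + 1))) := by
  have hr' : (0 : ℝ) < r := Nat.cast_pos.2 hr
  rw [Real.log_mul (Real.exp_ne_zero 1) (by positivity), Real.log_exp]
  exact Real.log_pos (lt_add_of_pos_right 1 (Real.log_pos (by linarith)))

theorem rate_eq_mul (hγ : 0 ≤ γ) : I.rate γ = √γ / (√γ - 1) *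
    (2 * √γ / (√γ - 1) * Real.log (Real.log (Real.exp 1 * ((I.r : ℝ) + 1)))) := by
  rw [rate]
  nth_rewrite 1 [← Real.mul_self_sqrt hγ]
  generalize √γ - 1 = d
  ring

theorem rate_nonneg (hγ : 0 ≤ γ) : 0 ≤ I.rate γ :=
  mul_nonneg (by positivity) (log_log_exp_one_mul_nonneg _)

variable [Fintype V]

theorem log_log_regionVol_div_beta_le (hx : ∀ v, 0 ≤ x v) (hβ : 0 < I.beta x) :
    Real.log (Real.log (Real.exp 1 * I.regionVol x S / I.beta x)) ≤
      Real.log (Real.log (Real.exp 1 * ((I.r : ℝ) + 1))) := by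
  have hvol := regionVol_div_beta_le (I := I) (S := S) hx
  have hlog := one_le_log_exp_one_mul_div hβ (beta_le_regionVol (S := S) hx)
  have hpos : 0 < I.regionVol x S := hβ.trans_le (beta_le_regionVol hx)
  rw [mul_div_assoc] at hlog ⊢
  gcongr

section DecidableEq

variable [DecidableEq V]

theorem goodRadius_iff : I.GoodRadius x y γ S i ρ ↔ 0 ≤ ρ ∧ ρ < 1 ∧
    (I.bdry x y S i (I.s i) ρ).card ≤
      I.rate γ * volLog (I.regionVol x S) (I.ballVol x y S i (I.s i) ρ) ∧
    (I.bdry x y S i (I.s i) ρ).card ≤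
      I.rate γ * volLog (I.regionVol x S) (I.coBallVol x y S i (I.s i) ρ) := by
  have hcomm : ∀ a w l L : ℝ, a * w * l * L = a * L * (w * l) := fun a w l L => by ring
  simp only [GoodRadius, rate, volLog, hcomm]

theorem volLog_sub_ballVol_le (hx : ∀ v, 0 ≤ x v) (hw : ∀ v, 0 ≤ x v + y i v)
    (hβ : 0 < I.beta x) :
    volLog (I.regionVol x S) (I.beta x + I.regionVol x S - I.ballVol x y S i z ρ) ≤
      volLog (I.regionVol x S) (I.coBallVol x y S i z ρ) := by
  have hball := ballVol_mem_Icc hx hw S z ρ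
  have hcoBall := coBallVol_mem_Icc hx hw S z ρ
  have hadd := ballVol_add_coBallVol hw S z ρ
  have hyBdry := Finset.sum_nonneg fun v (_ : v ∈ I.yBdry x y S i z ρ) => hx v
  exact volLog_monotoneOn ⟨by linarith [hball.2], by linarith [hball.1]⟩
    ⟨hβ.trans_le hcoBall.1, hcoBall.2⟩ (by linarith)

theorem source_mem_ball (h : I.LPFeasible x y) (hs : I.s i ∈ S) (hρ : 0 ≤ ρ) :
    I.s i ∈ I.ball x y S i (I.s i) ρ :=
  mem_ball.2 ⟨hs, .refl _, (ell_self_le_zero (h.weight_nonneg i) _).trans hρ⟩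

theorem sink_mem_coBall (h : I.LPFeasible x y) (ht : I.t i ∈ S)
    (hr : I.graph.Reachable (I.s i) (I.t i)) (hρ : ρ < 1) :
    I.t i ∈ I.coBall x y S i (I.s i) ρ := by
  have hfar := hρ.trans_le (h.one_le_ell hr)
  refine mem_coBall.2 ⟨ht, fun hb => hfar.not_ge (mem_ball.1 hb).2.2, fun hb => hfar.not_ge ?_⟩
  simpa [h.x_terminal _ ⟨i, .inr rfl⟩, h.y_sink i] using
    ell_le_of_mem_bdry (h.weight_nonneg i) hb

theorem ConnAtLeast.le_card_bdry (h : I.LPFeasible x y)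
    (hconn : I.ConnAtLeast S (I.s i) (I.t i) c) (hc : 0 < c) (h0 : 0 ≤ ρ) (h1 : ρ < 1) :
    c ≤ (I.bdry x y S i (I.s i) ρ).card := by
  obtain ⟨hs, ht, hr⟩ := hconn.ends_mem hc
  have hsource := source_mem_ball h hs h0
  have hsink := mem_coBall.1 (sink_mem_coBall h ht hr h1)
  obtain ⟨P, hP, hcard⟩ := hconn
  have : Nonempty V := ⟨I.s i⟩
  have hcross : ∀ p ∈ P, ∃ w ∈ I.bdry x y S i (I.s i) ρ, w ∈ p.1.support := fun p hp => by
    obtain ⟨d, hd, hin, hout⟩ :=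
      p.1.exists_boundary_dart (I.ball x y S i (I.s i) ρ : Set V) hsource hsink.2.1
    have hmem := p.1.dart_snd_mem_support_of_mem_darts hd
    exact ⟨d.snd, mem_bdry.2 ⟨⟨hP.1 p hp _ hmem, hout⟩, d.fst, hin, d.adj⟩, hmem⟩
  choose! f hf hfp using hcross
  have hinj : Set.InjOn f P := fun p hp q hq heq => by
    by_contra hne
    rcases hP.2 p hp q hq hne (f p) (hfp p hp) (heq ▸ hfp q hq) with hw | hw
    · exact Finset.disjoint_left.1 disjoint_ball_bdry hsource (hw ▸ hf p hp)
    · exact hsink.2.2 (hw ▸ hf p hp)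
  exact hcard.trans (by exact_mod_cast Finset.card_le_card_of_injOn f hf hinj)

theorem volume_large_yBdry_lt (h : I.LPFeasible x y) (S : Finset V) (i : Fin I.r) (z : V) {τ : ℝ}
    (hτ : 0 < τ) :
    volume {ρ : ℝ | τ * ((I.k : ℝ) - 1) < (I.yBdry x y S i z ρ).card} <
      ENNReal.ofReal (1 / τ) := by
  have hk : (0 : ℝ) ≤ I.k - 1 := (Finset.sum_nonneg fun v _ => h.y_nonneg i v).trans (h.budget i)
  let A (v : V) : Set ℝ := Set.Ico (I.ell x y i z v - y i v) (I.ell x y i z v)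
  set q := ⌊τ * ((I.k : ℝ) - 1)⌋₊ + 1
  have hq : τ * ((I.k : ℝ) - 1) < q := by
    rw [Nat.cast_add_one]
    exact Nat.lt_floor_add_one _
  have hsub : {ρ : ℝ | τ * ((I.k : ℝ) - 1) < (I.yBdry x y S i z ρ).card} ⊆
      {ρ | q ≤ (Finset.univ.filter fun v => ρ ∈ A v).card} := fun ρ hρ =>
    ((Nat.floor_lt (by positivity)).2 hρ).trans_le <| Finset.card_le_card fun v hv => by
      obtain ⟨-, hlt, hle⟩ := mem_yBdry.1 hv
      exact Finset.mem_filter.2 ⟨Finset.mem_univ v, by linarith, hlt⟩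
  have hsum : ∑ v, volume (A v) ≤ ENNReal.ofReal (I.k - 1) := by
    simp only [A, Real.volume_Ico, sub_sub_cancel]
    rw [← ENNReal.ofReal_sum_of_nonneg fun v _ => h.y_nonneg i v]
    exact ENNReal.ofReal_le_ofReal (h.budget i)
  calc volume {ρ : ℝ | τ * ((I.k : ℝ) - 1) < (I.yBdry x y S i z ρ).card}
      ≤ (∑ v, volume (A v)) / q := (measure_mono hsub).trans
        (meas_card_ge_le volume _ (fun _ _ => measurableSet_Ico) (Nat.succ_ne_zero _))
    _ ≤ ENNReal.ofReal (I.k - 1) / q := by gcongr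
    _ = ENNReal.ofReal ((I.k - 1) / q) := by
        rw [ENNReal.ofReal_div_of_pos (by positivity), ENNReal.ofReal_natCast]
    _ < ENNReal.ofReal (1 / τ) := by
        rw [ENNReal.ofReal_lt_ofReal_iff (by positivity),
          div_lt_div_iff₀ (by positivity) hτ, one_mul, mul_comm]
        exact hq

theorem card_bdry_le_of_small_yBdry (h : I.LPFeasible x y) (hk : 2 ≤ I.k) (hγ : 1 < γ)
    (hconn : I.ConnAtLeast S (I.s i) (I.t i) (γ * ((I.k : ℝ) - 1))) (h0 : 0 ≤ ρ) (h1 : ρ < 1)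
    (hρ : (I.yBdry x y S i (I.s i) ρ).card ≤ √γ * ((I.k : ℝ) - 1)) :
    (I.bdry x y S i (I.s i) ρ).card ≤ √γ / (√γ - 1) * (I.xBdry x y S i (I.s i) ρ).card := by
  have hk' := k_sub_one_pos hk
  have hsqrt : 1 < √γ := Real.lt_sqrt_of_sq_lt (by simpa using hγ)
  have hyBdry : √γ * (I.yBdry x y S i (I.s i) ρ).card ≤ (I.bdry x y S i (I.s i) ρ).card :=
    calc √γ * (I.yBdry x y S i (I.s i) ρ).card ≤ √γ * (√γ * ((I.k : ℝ) - 1)) := by gcongr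
      _ = γ * ((I.k : ℝ) - 1) := by rw [← mul_assoc, Real.mul_self_sqrt (by linarith)]
      _ ≤ (I.bdry x y S i (I.s i) ρ).card :=
        hconn.le_card_bdry h (mul_pos (by linarith) hk') h0 h1
  rw [div_mul_eq_mul_div, le_div_iff₀ (sub_pos.2 hsqrt)]
  rw [card_bdry (h.weight_nonneg i), Nat.cast_add] at hyBdry ⊢
  linarith

end DecidableEq

theorem beta_pos_of_connAtLeast (h : I.LPFeasible x y) (hk : 2 ≤ I.k) (hγ : 1 < γ)
    (hconn : I.ConnAtLeast S (I.s i) (I.t i) (γ * ((I.k : ℝ) - 1))) : 0 < I.beta x := by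
  classical
  have hpos : 0 < γ * ((I.k : ℝ) - 1) := mul_pos (by linarith) (k_sub_one_pos hk)
  have hsqrt : 1 < √γ := Real.lt_sqrt_of_sq_lt (by simpa using hγ)
  have hvol : volume {ρ : ℝ | √γ * ((I.k : ℝ) - 1) < (I.yBdry x y S i (I.s i) ρ).card} <
      volume (Set.Ico (0 : ℝ) 1) := by
    refine (volume_large_yBdry_lt h S i (I.s i) (by positivity)).trans_le ?_
    rw [Real.volume_Ico, sub_zero]
    exact ENNReal.ofReal_le_ofReal (div_le_one_of_le₀ hsqrt.le (by positivity))
  obtain ⟨ρ, ⟨h0, h1⟩, hρ⟩ := Set.not_subset.1 fun hsub => (measure_mono hsub).not_gt hvol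
  have hcard : (0 : ℝ) < √γ / (√γ - 1) * (I.xBdry x y S i (I.s i) ρ).card :=
    (hpos.trans_le (hconn.le_card_bdry h hpos h0 h1)).trans_le
      (card_bdry_le_of_small_yBdry h hk hγ hconn h0 h1 (not_lt.1 hρ))
  obtain ⟨v, hv⟩ : (I.xBdry x y S i (I.s i) ρ).Nonempty := by
    rw [Finset.nonempty_iff_ne_empty]
    intro hempty
    simp [hempty] at hcard
  have hxv : 0 < x v := by linarith [(mem_xBdry.1 hv).2]
  exact div_pos (Finset.sum_pos' (fun v _ => h.x_nonneg v) ⟨v, Finset.mem_univ v, hxv⟩)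
    (Nat.cast_pos.2 i.pos)

theorem exists_goodRadius [DecidableEq V] (h : I.LPFeasible x y) (hk : 2 ≤ I.k) (hγ : 1 < γ)
    (hconn : I.ConnAtLeast S (I.s i) (I.t i) (γ * ((I.k : ℝ) - 1))) :
    ∃ ρ : ℝ, I.GoodRadius x y γ S i ρ := by
  have hx := h.x_nonneg
  have hw := h.weight_nonneg i
  have hβ := beta_pos_of_connAtLeast h hk hγ hconn
  have hsqrt : 1 < √γ := Real.lt_sqrt_of_sq_lt (by simpa using hγ)
  have hpos : 0 < √γ - 1 := sub_pos.2 hsqrt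
  have hL := log_log_exp_one_mul_pos i.pos
  set L := Real.log (Real.log (Real.exp 1 * ((I.r : ℝ) + 1)))
  set c := 2 * √γ / (√γ - 1) * L with hc
  have hmeasure : 1 / √γ ≤ 1 - 0 -
      2 * (Real.log (Real.log (Real.exp 1 * I.regionVol x S / I.beta x)) / c) := by
    have hδ : Real.log (Real.log (Real.exp 1 * I.regionVol x S / I.beta x)) / c ≤ L / c := by
      gcongr
      exact log_log_regionVol_div_beta_le hx hβ
    have hLc : L / c = (1 - 1 / √γ) / 2 := by
      rw [hc]
      field_simp
    linarith
  obtain ⟨ρ, ⟨h0, h1⟩, hyBdry, hball, hcoBall⟩ := exists_radius_le_volLog hβ (by positivity)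
    zero_le_one (ballVol_mem_Icc hx hw S (I.s i)) (ballVol_mono hx (h.y_nonneg i))
    (ballVol_growth hx (h.y_nonneg i)) ((volume_large_yBdry_lt h S i (I.s i)
      (by positivity)).trans_le (ENNReal.ofReal_le_ofReal hmeasure))
  have hbdry : ∀ W, (I.xBdry x y S i (I.s i) ρ).card ≤ c * volLog (I.regionVol x S) W →
      (I.bdry x y S i (I.s i) ρ).card ≤ I.rate γ * volLog (I.regionVol x S) W := fun W hW => by
    rw [rate_eq_mul (zero_le_one.trans hγ.le), mul_assoc]
    refine (card_bdry_le_of_small_yBdry h hk hγ hconn h0 h1 (not_lt.1 hyBdry)).trans ?_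
    gcongr
  refine ⟨ρ, goodRadius_iff.2 ⟨h0, h1, hbdry _ hball, hbdry _ (hcoBall.trans ?_)⟩⟩
  gcongr
  exact volLog_sub_ballVol_le hx hw hβ

end GoodRadius

section Carving

variable {V : Type u} {I : NodeMulticut V} [DecidableEq V] {x : V → ℝ} {y : Fin I.r → V → ℝ}
  {S A D : Finset V} {T : Finset (Fin I.r)} {i j : Fin I.r} {ρ γ : ℝ}

theorem mem_pairsIn : j ∈ I.pairsIn T A ↔ j ∈ T ∧ I.s j ∈ A ∧ I.t j ∈ A := by
  simp [pairsIn]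

theorem pairsIn_subset : I.pairsIn T A ⊆ T := Finset.filter_subset _ _

theorem pairsIn_mono (h : A ⊆ D) : I.pairsIn T A ⊆ I.pairsIn T D :=
  Finset.monotone_filter_right T fun _ _ hj => ⟨h hj.1, h hj.2⟩

theorem pairsIn_disjoint (h : Disjoint A D) : Disjoint (I.pairsIn T A) (I.pairsIn T D) :=
  Finset.disjoint_left.2 fun _ hA hD =>
    Finset.disjoint_left.1 h (mem_pairsIn.1 hA).2.1 (mem_pairsIn.1 hD).2.1

variable [Fintype V]

variable (I x y) in
/-- The region left over by an iteration of the loop, which removes the carved-out set and the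
boundary from `S`. -/
noncomputable def residue (T : Finset (Fin I.r)) (S : Finset V) (i : Fin I.r) (ρ : ℝ) : Finset V :=
  S \ (I.carve x y T S i ρ ∪ I.bdry x y S i (I.s i) ρ)

theorem carve_eq_or :
    (I.carve x y T S i ρ = I.ball x y S i (I.s i) ρ ∧
      I.residue x y T S i ρ = I.coBall x y S i (I.s i) ρ) ∨
    (I.carve x y T S i ρ = I.coBall x y S i (I.s i) ρ ∧
      I.residue x y T S i ρ = I.ball x y S i (I.s i) ρ) := by
  rw [residue, carve]
  split_ifs
  · exact .inl ⟨rfl, rfl⟩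
  · refine .inr ⟨rfl, ?_⟩
    ext v
    have hS : v ∈ I.ball x y S i (I.s i) ρ → v ∈ S := fun hv => ball_subset hv
    have hbdry : v ∈ I.ball x y S i (I.s i) ρ → v ∉ I.bdry x y S i (I.s i) ρ :=
      fun hv => Finset.disjoint_left.1 disjoint_ball_bdry hv
    rw [Finset.mem_sdiff, Finset.mem_union, mem_coBall]
    tauto

theorem carve_subset : I.carve x y T S i ρ ⊆ S := by
  rcases carve_eq_or (T := T) with ⟨h, -⟩ | ⟨h, -⟩ <;> rw [h]
  exacts [ball_subset, coBall_subset]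

theorem residue_subset : I.residue x y T S i ρ ⊆ S := Finset.sdiff_subset

theorem disjoint_residue_carve :
    Disjoint (I.residue x y T S i ρ) (I.carve x y T S i ρ) :=
  Finset.disjoint_left.2 fun _ hv hA =>
    (Finset.mem_sdiff.1 hv).2 (Finset.mem_union_left _ hA)

theorem card_pairsIn_carve_le : 2 * (I.pairsIn T (I.carve x y T S i ρ)).card ≤ T.card := by
  rw [carve]
  split_ifs with h
  · exact (Nat.mul_le_mul_left 2 (Finset.card_le_card
      (pairsIn_mono Finset.subset_union_left))).trans h
  · have hdisj : Disjoint (I.coBall x y S i (I.s i) ρ)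
        (I.ball x y S i (I.s i) ρ ∪ I.yBdry x y S i (I.s i) ρ) :=
      Finset.disjoint_union_right.2
        ⟨disjoint_coBall_ball, disjoint_coBall_bdry.mono_right yBdry_subset⟩
    have hcard := Finset.card_le_card (Finset.union_subset
      (pairsIn_subset (T := T) (A := I.coBall x y S i (I.s i) ρ))
      (pairsIn_subset (A := I.ball x y S i (I.s i) ρ ∪ I.yBdry x y S i (I.s i) ρ)))
    rw [Finset.card_union_of_disjoint (pairsIn_disjoint hdisj)] at hcard
    omega

theorem notMem_pairsIn_carve_residue (hs : I.s i ∈ I.ball x y S i (I.s i) ρ)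
    (ht : I.t i ∈ I.coBall x y S i (I.s i) ρ) :
    i ∉ I.pairsIn T (I.carve x y T S i ρ) ∧ i ∉ I.pairsIn T (I.residue x y T S i ρ) := by
  have hdisj := Finset.disjoint_left.1 (disjoint_coBall_ball (x := x) (y := y) (S := S) (i := i)
    (z := I.s i) (ρ := ρ))
  simp only [mem_pairsIn, not_and]
  rcases carve_eq_or (T := T) with ⟨hA, hR⟩ | ⟨hA, hR⟩ <;> rw [hA, hR]
  exacts [⟨fun _ _ => hdisj ht, fun _ h => (hdisj h hs).elim⟩,
    ⟨fun _ h => (hdisj h hs).elim, fun _ _ => hdisj ht⟩]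

theorem card_pairsIn_residue_add_carve_lt (hi : i ∈ T)
    (hs : I.s i ∈ I.ball x y S i (I.s i) ρ) (ht : I.t i ∈ I.coBall x y S i (I.s i) ρ) :
    (I.pairsIn T (I.residue x y T S i ρ)).card + (I.pairsIn T (I.carve x y T S i ρ)).card <
      (I.pairsIn T S).card := by
  obtain ⟨hA, hR⟩ := notMem_pairsIn_carve_residue (T := T) hs ht
  rw [← Finset.card_union_of_disjoint (pairsIn_disjoint disjoint_residue_carve)]
  refine Finset.card_lt_card (Finset.ssubset_iff_of_subset (Finset.union_subset
    (pairsIn_mono residue_subset) (pairsIn_mono carve_subset)) |>.2 ⟨i, ?_, ?_⟩)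
  · exact mem_pairsIn.2 ⟨hi, ball_subset hs, coBall_subset ht⟩
  · exact Finset.notMem_union.2 ⟨hR, hA⟩

theorem carve_ssubset_and_residue_ssubset (hi : i ∈ T) (hs : I.s i ∈ I.ball x y S i (I.s i) ρ)
    (ht : I.t i ∈ I.coBall x y S i (I.s i) ρ) :
    I.carve x y T S i ρ ⊂ S ∧ I.residue x y T S i ρ ⊂ S := by
  obtain ⟨hA, hR⟩ := notMem_pairsIn_carve_residue (T := T) hs ht
  have hiS : i ∈ I.pairsIn T S := mem_pairsIn.2 ⟨hi, ball_subset hs, coBall_subset ht⟩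
  exact ⟨carve_subset.ssubset_of_ne fun h => hA (h.symm ▸ hiS),
    residue_subset.ssubset_of_ne fun h => hR (h.symm ▸ hiS)⟩

theorem GoodRadius.exists_volume (h : I.GoodRadius x y γ S i ρ) (hx : ∀ v, 0 ≤ x v)
    (hw : ∀ v, 0 ≤ x v + y i v) (T : Finset (Fin I.r)) :
    ∃ W, I.regionVol x (I.carve x y T S i ρ) ≤ W ∧
      W + ∑ v ∈ I.residue x y T S i ρ, x v ≤ I.regionVol x S ∧
      (I.bdry x y S i (I.s i) ρ).card ≤ I.rate γ * volLog (I.regionVol x S) W := by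
  obtain ⟨-, -, hball, hcoBall⟩ := goodRadius_iff.1 h
  rcases carve_eq_or (T := T) with ⟨hA, hR⟩ | ⟨hA, hR⟩ <;> rw [hA, hR]
  · exact ⟨_, regionVol_ball_le hx, ballVol_add_sum_coBall_le hw S _ ρ, hball⟩
  · exact ⟨_, regionVol_coBall_le hx, coBallVol_add_sum_ball_le hw S _ ρ, hcoBall⟩

end Carving

section ClosedIn

variable {V : Type u} {I : NodeMulticut V} {A D : Finset V}

variable (I) in
/-- No edge leads from `A` to a node of `D` outside `A`: a path of `D` that meets `A` stays in `A`,
so that `A` can be treated as a separate instance. -/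
def ClosedIn (D A : Finset V) : Prop := ∀ u ∈ A, ∀ v ∈ D, I.graph.Adj u v → v ∈ A

theorem ClosedIn.anti {D' : Finset V} (h : I.ClosedIn D A) (hD : D' ⊆ D) : I.ClosedIn D' A :=
  fun u hu v hv => h u hu v (hD hv)

theorem ClosedIn.support_subset (h : I.ClosedIn D A) {a b : V} (p : I.graph.Walk a b)
    (hp : ∀ w ∈ p.support, w ∈ D) (ha : a ∈ A) : ∀ w ∈ p.support, w ∈ A := by
  induction p with
  | nil => simpa using ha
  | cons hadj p ih =>
    simp only [SimpleGraph.Walk.support_cons, List.forall_mem_cons] at hp ⊢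
    exact ⟨ha, ih hp.2 (h _ ha _ (hp.2 _ p.start_mem_support) hadj)⟩

variable [Fintype V] [DecidableEq V] {x : V → ℝ} {y : Fin I.r → V → ℝ} {S : Finset V}
  {i : Fin I.r} {z : V} {ρ : ℝ}

theorem closedIn_ball : I.ClosedIn (S \ I.bdry x y S i z ρ) (I.ball x y S i z ρ) :=
  fun u hu v hv hadj => by
    rw [Finset.mem_sdiff] at hv
    by_contra hb
    exact hv.2 (mem_bdry.2 ⟨⟨hv.1, hb⟩, u, hu, hadj⟩)

theorem closedIn_coBall : I.ClosedIn (S \ I.bdry x y S i z ρ) (I.coBall x y S i z ρ) :=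
  fun u hu v hv hadj => by
    rw [Finset.mem_sdiff] at hv
    obtain ⟨hS, hball, hbdry⟩ := mem_coBall.1 hu
    exact mem_coBall.2
      ⟨hv.1, fun hb => hbdry (mem_bdry.2 ⟨⟨hS, hball⟩, v, hb, hadj.symm⟩), hv.2⟩

theorem closedIn_carve_and_residue (T : Finset (Fin I.r)) :
    I.ClosedIn (S \ I.bdry x y S i (I.s i) ρ) (I.carve x y T S i ρ) ∧
      I.ClosedIn (S \ I.bdry x y S i (I.s i) ρ) (I.residue x y T S i ρ) := by
  rcases carve_eq_or (T := T) with ⟨hA, hR⟩ | ⟨hA, hR⟩ <;> rw [hA, hR]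
  exacts [⟨closedIn_ball, closedIn_coBall⟩, ⟨closedIn_coBall, closedIn_ball⟩]

end ClosedIn

section Algorithm

variable {V : Type u} {I : NodeMulticut V} [Fintype V] [DecidableEq V] {x : V → ℝ}
  {y : Fin I.r → V → ℝ} {U S Z : Finset V} {T : Finset (Fin I.r)} {C : Finset (Finset V)}
  {i : Fin I.r} {γ ρ : ℝ}

theorem LoopReaches.subset (h : I.LoopReaches x y γ U T S C Z) : S ⊆ U := by
  induction h with
  | start => exact subset_rfl
  | step _ _ _ _ _ _ _ _ _ ih => exact residue_subset.trans ih

theorem GoodRadius.ends_mem (hρ : I.GoodRadius x y γ S i ρ) (h : I.LPFeasible x y) (hk : 2 ≤ I.k)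
    (hγ : 1 < γ) (hconn : I.ConnAtLeast S (I.s i) (I.t i) (γ * ((I.k : ℝ) - 1))) :
    I.s i ∈ I.ball x y S i (I.s i) ρ ∧ I.t i ∈ I.coBall x y S i (I.s i) ρ := by
  obtain ⟨hs, ht, hr⟩ := hconn.ends_mem (mul_pos (by linarith) (k_sub_one_pos hk))
  exact ⟨source_mem_ball h hs hρ.1, sink_mem_coBall h ht hr hρ.2.1⟩

theorem LoopReaches.ssubset (h : I.LPFeasible x y) (hk : 2 ≤ I.k) (hγ : 1 < γ)
    (hloop : I.LoopReaches x y γ U T S C Z) : ∀ A ∈ C, A ⊂ U := by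
  induction hloop with
  | start => simp
  | step S C Z i ρ hloop hi hconn hρ ih =>
    obtain ⟨hs, ht⟩ := hρ.ends_mem h hk hγ hconn
    exact Finset.forall_mem_insert _ _ _ |>.2
      ⟨(carve_ssubset_and_residue_ssubset hi hs ht).1.trans_subset hloop.subset, ih⟩

theorem LoopReaches.exists_final (h : I.LPFeasible x y) (hk : 2 ≤ I.k) (hγ : 1 < γ)
    (hloop : I.LoopReaches x y γ U T S C Z) :
    ∃ S' C' Z', I.LoopReaches x y γ U T S' C' Z' ∧
      ∀ i ∈ T, ¬ I.ConnAtLeast S' (I.s i) (I.t i) (γ * ((I.k : ℝ) - 1)) := by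
  induction S using Finset.strongInduction generalizing C Z with
  | H S ih =>
    by_cases hdone : ∀ i ∈ T, ¬ I.ConnAtLeast S (I.s i) (I.t i) (γ * ((I.k : ℝ) - 1))
    · exact ⟨S, C, Z, hloop, hdone⟩
    push Not at hdone
    obtain ⟨i, hi, hconn⟩ := hdone
    obtain ⟨ρ, hρ⟩ := exists_goodRadius h hk hγ hconn
    obtain ⟨hs, ht⟩ := hρ.ends_mem h hk hγ hconn
    exact ih _ (carve_ssubset_and_residue_ssubset hi hs ht).2 (hloop.step S C Z i ρ hi hconn hρ)

theorem exists_returns (h : I.LPFeasible x y) (hk : 2 ≤ I.k) (hγ : 1 < γ) (U : Finset V)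
    (T : Finset (Fin I.r)) : ∃ Z, I.Returns x y γ U T Z := by
  induction U using Finset.strongInduction generalizing T with
  | H U ih =>
    obtain ⟨S, C, Z, hloop, hdone⟩ :=
      (LoopReaches.start : I.LoopReaches x y γ U T U ∅ ∅).exists_final h hk hγ
    choose! Zrec hZrec using fun A hA => ih A (hloop.ssubset h hk hγ A hA) (I.pairsIn T A)
    exact ⟨_, .intro U T S C Z Zrec hloop hdone hZrec⟩

theorem LoopReaches.sdiff_subset_union (hloop : I.LoopReaches x y γ U T S C Z) :
    U \ Z ⊆ S ∪ C.biUnion id := by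
  induction hloop with
  | start => simp
  | step S C Z i ρ _ _ _ _ ih =>
    intro v hv
    rw [Finset.mem_sdiff, Finset.notMem_union] at hv
    have hcover := ih (Finset.mem_sdiff.2 ⟨hv.1, hv.2.1⟩)
    simp only [Finset.biUnion_insert, Finset.mem_union, Finset.mem_sdiff, id] at hcover ⊢
    tauto

theorem LoopReaches.closedIn (hloop : I.LoopReaches x y γ U T S C Z) :
    I.ClosedIn (U \ Z) S ∧ ∀ A ∈ C, I.ClosedIn (U \ Z) A := by
  induction hloop with
  | start => exact ⟨fun u _ v hv _ => (Finset.mem_sdiff.1 hv).1, by simp⟩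
  | step S C Z i ρ _ _ _ _ ih =>
    obtain ⟨hS, hC⟩ := ih
    rw [show U \ (Z ∪ I.bdry x y S i (I.s i) ρ) = (U \ Z) \ I.bdry x y S i (I.s i) ρ from
      sdiff_sdiff_left.symm]
    have hlift : ∀ E ⊆ S, I.ClosedIn (S \ I.bdry x y S i (I.s i) ρ) E →
        I.ClosedIn ((U \ Z) \ I.bdry x y S i (I.s i) ρ) E := fun E hES hE u hu v hv hadj => by
      rw [Finset.mem_sdiff] at hv
      exact hE u hu v (Finset.mem_sdiff.2 ⟨hS u (hES hu) v hv.1 hadj, hv.2⟩) hadj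
    obtain ⟨hA, hR⟩ := closedIn_carve_and_residue (x := x) (y := y) (S := S) (i := i) (ρ := ρ) T
    exact ⟨hlift _ residue_subset hR, Finset.forall_mem_insert _ _ _ |>.2
      ⟨hlift _ carve_subset hA, fun E hE => (hC E hE).anti Finset.sdiff_subset⟩⟩

theorem Returns.connLess (hpos : 0 < γ * ((I.k : ℝ) - 1)) (hret : I.Returns x y γ U T Z) :
    ∀ i ∈ T, I.ConnLess (U \ Z) (I.s i) (I.t i) (γ * ((I.k : ℝ) - 1)) := by
  induction hret with
  | intro U T S C Z Zrec hloop hdone _ ih =>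
    intro i hi P hP
    by_contra! hcard
    obtain ⟨hsU, -, -⟩ := ConnAtLeast.ends_mem ⟨P, hP, hcard⟩ hpos
    obtain ⟨hS, hC⟩ := hloop.closedIn
    have hsub : U \ (Z ∪ C.biUnion Zrec) ⊆ U \ Z :=
      Finset.sdiff_subset_sdiff subset_rfl Finset.subset_union_left
    have hstay : ∀ A, I.ClosedIn (U \ Z) A → I.s i ∈ A → ∀ p ∈ P, ∀ w ∈ p.1.support, w ∈ A :=
      fun A hA hsA p hp => hA.support_subset p.1 (fun w hw => hsub (hP.1 p hp w hw)) hsA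
    rcases Finset.mem_union.1 (hloop.sdiff_subset_union (hsub hsU)) with hsS | hsC
    · exact hdone i hi ⟨P, ⟨hstay S hS hsS, hP.2⟩, hcard⟩
    · obtain ⟨A, hA, hsA⟩ := Finset.mem_biUnion.1 hsC
      have hPA : I.NodeDisjoint (A \ Zrec A) P :=
        ⟨fun p hp w hw => Finset.mem_sdiff.2 ⟨hstay A (hC A hA) hsA p hp w hw, fun hwZ =>
          (Finset.mem_sdiff.1 (hP.1 p hp w hw)).2
            (Finset.mem_union_right _ (Finset.mem_biUnion.2 ⟨A, hA, hwZ⟩))⟩, hP.2⟩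
      obtain ⟨-, htA, -⟩ := ConnAtLeast.ends_mem ⟨P, hPA, hcard⟩ hpos
      have hiA : i ∈ I.pairsIn T A := mem_pairsIn.2 ⟨hi, hsA, Finset.sdiff_subset htA⟩
      exact (ih A hA i hiA P hPA).not_ge hcard

theorem LoopReaches.y_pos_of_terminal (h : I.LPFeasible x y)
    (hloop : I.LoopReaches x y γ U T S C Z) : ∀ v ∈ Z, I.IsTerminal v → ∃ i, 0 < y i v := by
  induction hloop with
  | start => simp
  | step _ _ _ i _ _ _ _ _ ih =>
    intro v hv hterm
    rcases Finset.mem_union.1 hv with hv | hv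
    · exact ih v hv hterm
    · have hlt := lt_ell_of_mem_bdry hv
      have hle := ell_le_of_mem_bdry (h.weight_nonneg i) hv
      rw [h.x_terminal v hterm] at hle
      exact ⟨i, by linarith⟩

theorem Returns.y_pos_of_terminal (h : I.LPFeasible x y) (hret : I.Returns x y γ U T Z) :
    ∀ v ∈ Z, I.IsTerminal v → ∃ i, 0 < y i v := by
  induction hret with
  | intro U T S C Z Zrec hloop _ _ ih =>
    intro v hv hterm
    rcases Finset.mem_union.1 hv with hv | hv
    · exact hloop.y_pos_of_terminal h v hv hterm
    · obtain ⟨A, hA, hvA⟩ := Finset.mem_biUnion.1 hv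
      exact ih A hA v hvA hterm

end Algorithm

section Cost

variable {V : Type u} {I : NodeMulticut V} {x : V → ℝ} {y : Fin I.r → V → ℝ} {A S U Z : Finset V}
  {T : Finset (Fin I.r)} {C : Finset (Finset V)} {i : Fin I.r} {γ ρ W : ℝ}

theorem three_mul_log_half_add_one_le {m n : ℕ} (hn : 0 < n) (hmn : 2 * m ≤ n) :
    3 * Real.log (m + 1) + 1 ≤ 3 * Real.log (n + 1) := by
  have hthird : (1 : ℝ) / 3 ≤ Real.log (3 / 2) := by
    have h := Real.one_sub_inv_le_log_of_pos (show (0 : ℝ) < 3 / 2 by norm_num)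
    norm_num at h ⊢
    exact h
  have hle : (3 / 2 : ℝ) * (m + 1) ≤ n + 1 := by
    have hmn' : (3 : ℝ) * (m + 1) ≤ 2 * (n + 1) := by exact_mod_cast (by omega)
    linarith
  have hlog := Real.log_le_log (by positivity) hle
  rw [Real.log_mul (by norm_num) (by positivity)] at hlog
  linarith

variable [Fintype V]

theorem regionVol_mono (hx : ∀ v, 0 ≤ x v) (h : S ⊆ U) : I.regionVol x S ≤ I.regionVol x U := by
  rw [regionVol, regionVol]
  gcongr
  exact fun v _ _ => hx v

variable (I x) in
/-- The amount that a call `(U, T)` may spend per unit of `credit` and of `rate`. At `β = 0` it is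
`3 ln (|T| + 1)`, because `x / 0 = 0` and `ln 0 = 0`. -/
noncomputable def price (U : Finset V) (T : Finset (Fin I.r)) : ℝ :=
  Real.log (I.regionVol x U / I.beta x) + 3 * Real.log (T.card + 1)

theorem price_nonneg (hx : ∀ v, 0 ≤ x v) : 0 ≤ I.price x U T := by
  refine add_nonneg ?_ (mul_nonneg zero_le_three (Real.log_nonneg (by simp)))
  rcases (beta_nonneg (I := I) hx).eq_or_lt with hβ | hβ
  · simp [← hβ]
  · exact Real.log_nonneg ((one_le_div hβ).2 (beta_le_regionVol hx))

variable [DecidableEq V]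

variable (I x) in
/-- The fractional cost of a region `S`, together with a share `β` of the optimum for each pair of
`T` inside `S`. -/
noncomputable def credit (T : Finset (Fin I.r)) (S : Finset V) : ℝ :=
  ∑ v ∈ S, x v + I.beta x * (I.pairsIn T S).card

variable (I x) in
/-- The bound, up to the factor `rate`, on the size of what the call `(U, T)` returns. -/
noncomputable def callBound (U : Finset V) (T : Finset (Fin I.r)) : ℝ :=
  I.credit x T U * I.price x U T

theorem credit_nonneg (hx : ∀ v, 0 ≤ x v) : 0 ≤ I.credit x T S :=
  add_nonneg (Finset.sum_nonneg fun v _ => hx v) (mul_nonneg (beta_nonneg hx) (Nat.cast_nonneg _))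

theorem callBound_nonneg (hx : ∀ v, 0 ≤ x v) : 0 ≤ I.callBound x U T :=
  mul_nonneg (credit_nonneg hx) (price_nonneg hx)

theorem volLog_add_callBound_le (hx : ∀ v, 0 ≤ x v) (hβ : 0 < I.beta x) (hT : T.Nonempty)
    (hA : I.regionVol x A ≤ W) (hU : W ≤ I.regionVol x U)
    (hcard : 2 * (I.pairsIn T A).card ≤ T.card) :
    volLog (I.regionVol x U) W + I.callBound x A (I.pairsIn T A) ≤
      (W + I.beta x * (I.pairsIn T A).card) * I.price x U T := by
  let n : ℝ := (I.pairsIn T A).card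
  obtain ⟨priceW, hpriceW⟩ : ∃ p, p = Real.log (W / I.beta x) + 3 * Real.log (T.card + 1) :=
    ⟨_, rfl⟩
  have hW : 0 < W := hβ.trans_le ((beta_le_regionVol hx).trans hA)
  have hvolU : 0 < I.regionVol x U := hβ.trans_le (beta_le_regionVol hx)
  have hvolA : 0 < I.regionVol x A := hβ.trans_le (beta_le_regionVol hx)
  have hvolLog : volLog (I.regionVol x U) W = W * (1 + (I.price x U T - priceW)) := by
    rw [volLog, log_exp_one_mul_div hW hvolU, price, hpriceW, Real.log_div hvolU.ne' hβ.ne',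
      Real.log_div hW.ne' hβ.ne']
    ring
  have hdrop : I.price x A (I.pairsIn T A) ≤ priceW - 1 := by
    have hlog : Real.log (I.regionVol x A / I.beta x) ≤ Real.log (W / I.beta x) := by gcongr
    have hhalf := three_mul_log_half_add_one_le hT.card_pos hcard
    rw [price, hpriceW]
    linarith
  have hrise : priceW ≤ I.price x U T := by
    rw [price, hpriceW]
    gcongr
  have hcredit : I.credit x (I.pairsIn T A) A ≤ W + I.beta x * n := by
    rw [credit]
    gcongr
    · exact (le_add_of_nonneg_left hβ.le).trans hA
    · exact Nat.cast_le.2 (Finset.card_le_card pairsIn_subset)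
  have hsum : I.callBound x A (I.pairsIn T A) ≤ (W + I.beta x * n) * (priceW - 1) :=
    mul_le_mul hcredit hdrop (price_nonneg hx) ((credit_nonneg hx).trans hcredit)
  have hn : 0 ≤ I.beta x * n := by positivity
  calc volLog (I.regionVol x U) W + I.callBound x A (I.pairsIn T A)
      ≤ W * (1 + (I.price x U T - priceW)) + (W + I.beta x * n) * (priceW - 1) :=
        add_le_add hvolLog.le hsum
    _ = W * I.price x U T + I.beta x * n * (priceW - 1) := by ring
    _ ≤ W * I.price x U T + I.beta x * n * I.price x U T := by
        gcongr
        linarith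
    _ = (W + I.beta x * n) * I.price x U T := by ring

theorem credit_residue_le (hβ : 0 ≤ I.beta x) (hi : i ∈ T)
    (hs : I.s i ∈ I.ball x y S i (I.s i) ρ) (ht : I.t i ∈ I.coBall x y S i (I.s i) ρ)
    (hR : W + ∑ v ∈ I.residue x y T S i ρ, x v ≤ I.regionVol x S) :
    W + I.beta x * (I.pairsIn T (I.carve x y T S i ρ)).card
      + I.credit x T (I.residue x y T S i ρ) ≤ I.credit x T S := by
  have hpairs : ((I.pairsIn T (I.residue x y T S i ρ)).card : ℝ)
      + (I.pairsIn T (I.carve x y T S i ρ)).card + 1 ≤ (I.pairsIn T S).card := by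
    exact_mod_cast card_pairsIn_residue_add_carve_lt hi hs ht
  have hshare := mul_le_mul_of_nonneg_left hpairs hβ
  rw [regionVol] at hR
  rw [credit, credit]
  linarith

theorem GoodRadius.iteration_cost_le (hρ : I.GoodRadius x y γ S i ρ) (h : I.LPFeasible x y)
    (hk : 2 ≤ I.k) (hγ : 1 < γ) (hi : i ∈ T)
    (hconn : I.ConnAtLeast S (I.s i) (I.t i) (γ * ((I.k : ℝ) - 1))) (hSU : S ⊆ U) :
    (I.bdry x y S i (I.s i) ρ).card + I.rate γ *
      (I.callBound x (I.carve x y T S i ρ) (I.pairsIn T (I.carve x y T S i ρ))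
        + I.credit x T (I.residue x y T S i ρ) * I.price x U T) ≤
      I.rate γ * (I.credit x T S * I.price x U T) := by
  have hx := h.x_nonneg
  have hrate := I.rate_nonneg (γ := γ) (by linarith)
  have hβ := beta_pos_of_connAtLeast h hk hγ hconn
  obtain ⟨hs, ht⟩ := hρ.ends_mem h hk hγ hconn
  obtain ⟨W, hA, hR, hbdry⟩ := hρ.exists_volume hx (h.weight_nonneg i) T
  have hW : 0 < W := hβ.trans_le ((beta_le_regionVol hx).trans hA)
  have hvolS : 0 < I.regionVol x S := hβ.trans_le (beta_le_regionVol hx)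
  have hvolSU : I.regionVol x S ≤ I.regionVol x U := regionVol_mono hx hSU
  have hWS : W ≤ I.regionVol x S :=
    (le_add_of_nonneg_right (Finset.sum_nonneg fun v _ => hx v)).trans hR
  have hvolLog : volLog (I.regionVol x S) W ≤ volLog (I.regionVol x U) W := by
    rw [volLog, volLog]
    gcongr
  have hcall := volLog_add_callBound_le hx hβ ⟨i, hi⟩ hA (hWS.trans hvolSU) card_pairsIn_carve_le
  have hcredit := mul_le_mul_of_nonneg_right (credit_residue_le hβ.le hi hs ht hR)
    (price_nonneg (U := U) (T := T) hx)
  calc _ ≤ I.rate γ * volLog (I.regionVol x S) W + I.rate γ *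
        (I.callBound x (I.carve x y T S i ρ) (I.pairsIn T (I.carve x y T S i ρ))
          + I.credit x T (I.residue x y T S i ρ) * I.price x U T) := by gcongr
    _ ≤ I.rate γ * (I.credit x T S * I.price x U T) := by
        rw [← mul_add]
        gcongr
        linarith

theorem LoopReaches.cost_le (h : I.LPFeasible x y) (hk : 2 ≤ I.k) (hγ : 1 < γ)
    (hloop : I.LoopReaches x y γ U T S C Z) :
    Z.card + I.rate γ * (∑ A ∈ C, I.callBound x A (I.pairsIn T A)
      + I.credit x T S * I.price x U T) ≤ I.rate γ * I.callBound x U T := by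
  induction hloop with
  | start => simp [callBound]
  | step S C Z i ρ hloop hi hconn hρ ih =>
    have hrate := I.rate_nonneg (γ := γ) (by linarith)
    have hiter := hρ.iteration_cost_le h hk hγ hi hconn hloop.subset
    have hinsert : ∑ A ∈ insert (I.carve x y T S i ρ) C, I.callBound x A (I.pairsIn T A) ≤
        I.callBound x (I.carve x y T S i ρ) (I.pairsIn T (I.carve x y T S i ρ))
          + ∑ A ∈ C, I.callBound x A (I.pairsIn T A) := by
      by_cases hmem : I.carve x y T S i ρ ∈ C
      · rw [Finset.insert_eq_of_mem hmem]
        exact le_add_of_nonneg_left (callBound_nonneg h.x_nonneg)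
      · exact (Finset.sum_insert hmem).le
    have hunion : ((Z ∪ I.bdry x y S i (I.s i) ρ).card : ℝ) ≤
        Z.card + (I.bdry x y S i (I.s i) ρ).card := by
      exact_mod_cast Finset.card_union_le _ _
    have hinsert' := mul_le_mul_of_nonneg_left hinsert hrate
    rw [residue] at hiter
    linarith

theorem Returns.cost_le (h : I.LPFeasible x y) (hk : 2 ≤ I.k) (hγ : 1 < γ)
    (hret : I.Returns x y γ U T Z) : Z.card ≤ I.rate γ * I.callBound x U T := by
  induction hret with
  | intro U T S C Z Zrec hloop _ _ ih =>
    have hx := h.x_nonneg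
    have hrate := I.rate_nonneg (γ := γ) (by linarith)
    have hcard : (Z ∪ C.biUnion Zrec).card ≤ Z.card + ∑ A ∈ C, (Zrec A).card :=
      (Finset.card_union_le _ _).trans (by gcongr; exact Finset.card_biUnion_le)
    calc ((Z ∪ C.biUnion Zrec).card : ℝ) ≤ Z.card + ∑ A ∈ C, ((Zrec A).card : ℝ) := by
          exact_mod_cast hcard
      _ ≤ Z.card + ∑ A ∈ C, I.rate γ * I.callBound x A (I.pairsIn T A) := by
          gcongr with A hA
          exact ih A hA
      _ ≤ Z.card + I.rate γ * (∑ A ∈ C, I.callBound x A (I.pairsIn T A)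
            + I.credit x T S * I.price x U T) := by
          rw [← Finset.mul_sum]
          gcongr
          exact le_add_of_nonneg_right (mul_nonneg (credit_nonneg hx) (price_nonneg hx))
      _ ≤ I.rate γ * I.callBound x U T := hloop.cost_le h hk hγ

theorem callBound_univ_le (hx : ∀ v, 0 ≤ x v) :
    I.callBound x Finset.univ Finset.univ ≤ 8 * (∑ v, x v) * Real.log (I.r + 1) := by
  have hcredit : I.credit x Finset.univ Finset.univ ≤ 2 * ∑ v, x v := by
    have hβ := beta_mul_r_le (I := I) hx
    simp only [credit, pairsIn, Finset.mem_univ, and_self, Finset.filter_true, Finset.card_univ,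
      Fintype.card_fin]
    linarith
  have hprice : I.price x Finset.univ Finset.univ ≤ 4 * Real.log (I.r + 1) := by
    have hlog : Real.log (I.regionVol x Finset.univ / I.beta x) ≤ Real.log (I.r + 1) := by
      rcases (beta_nonneg (I := I) hx).eq_or_lt with hβ | hβ
      · simpa [← hβ] using Real.log_nonneg (by simp)
      · exact Real.log_le_log (div_pos (hβ.trans_le (beta_le_regionVol hx)) hβ)
          (regionVol_div_beta_le hx)
    rw [price, Finset.card_univ, Fintype.card_fin]
    linarith
  calc I.callBound x Finset.univ Finset.univ ≤ 2 * (∑ v, x v) * (4 * Real.log (I.r + 1)) :=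
        mul_le_mul hcredit hprice (price_nonneg hx) ((credit_nonneg hx).trans hcredit)
    _ = 8 * (∑ v, x v) * Real.log (I.r + 1) := by ring

end Cost

section LogBounds

theorem one_lt_log_max_three (r : ℝ) : 1 < Real.log (max r 3) := by
  rw [Real.lt_log_iff_exp_lt (by positivity)]
  exact Real.exp_one_lt_three.trans_le (le_max_right _ _)

theorem lnTimesLnLn_nonneg (r : ℕ) : 0 ≤ lnTimesLnLn r :=
  have h := one_lt_log_max_three r
  mul_nonneg (by linarith) (Real.log_nonneg h.le)

theorem log_add_one_le {r : ℝ} (hr : 0 ≤ r) : Real.log (r + 1) ≤ 2 * Real.log (max r 3) := by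
  have hmax : r + 1 ≤ max r 3 ^ 2 := by nlinarith [le_max_left r 3, le_max_right r 3]
  calc Real.log (r + 1) ≤ Real.log (max r 3 ^ 2) := Real.log_le_log (by linarith) hmax
    _ = 2 * Real.log (max r 3) := by rw [Real.log_pow, Nat.cast_ofNat]

theorem log_log_exp_one_mul_le {r : ℝ} (hr : 0 ≤ r) :
    Real.log (Real.log (Real.exp 1 * (r + 1))) ≤
      (1 + Real.log 3 / Real.log (Real.log 3)) * Real.log (Real.log (max r 3)) := by
  have hlog := one_lt_log_max_three r
  have hlog3 : 1 < Real.log 3 := by simpa using one_lt_log_max_three 3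
  have hloglog3 := Real.log_pos hlog3
  have hinner : Real.log (Real.exp 1 * (r + 1)) = 1 + Real.log (r + 1) := by
    rw [Real.log_mul (Real.exp_ne_zero 1) (by linarith), Real.log_exp]
  have hpos : 0 ≤ Real.log (r + 1) := Real.log_nonneg (by linarith)
  have habsorb : Real.log 3 ≤
      Real.log 3 / Real.log (Real.log 3) * Real.log (Real.log (max r 3)) := by
    rw [div_mul_eq_mul_div, le_div_iff₀ hloglog3]
    gcongr
    exact le_max_right _ _
  calc Real.log (Real.log (Real.exp 1 * (r + 1))) ≤ Real.log (3 * Real.log (max r 3)) := by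
        rw [hinner]
        exact Real.log_le_log (by linarith) (by linarith [log_add_one_le hr])
    _ = Real.log 3 + Real.log (Real.log (max r 3)) := Real.log_mul three_ne_zero (by linarith)
    _ ≤ _ := by linarith

theorem exists_log_mul_log_log_le : ∃ c : ℝ, 0 < c ∧ ∀ r : ℕ,
    Real.log (r + 1) * Real.log (Real.log (Real.exp 1 * ((r : ℝ) + 1))) ≤ c * lnTimesLnLn r := by
  have hlog3 : 1 < Real.log 3 := by simpa using one_lt_log_max_three 3
  have hloglog3 := Real.log_pos hlog3
  refine ⟨2 * (1 + Real.log 3 / Real.log (Real.log 3)), by positivity, fun r => ?_⟩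
  have hlog := one_lt_log_max_three r
  calc Real.log (r + 1) * Real.log (Real.log (Real.exp 1 * ((r : ℝ) + 1)))
      ≤ 2 * Real.log (max (r : ℝ) 3) *
        ((1 + Real.log 3 / Real.log (Real.log 3)) * Real.log (Real.log (max (r : ℝ) 3))) :=
        mul_le_mul (log_add_one_le r.cast_nonneg) (log_log_exp_one_mul_le r.cast_nonneg)
          (log_log_exp_one_mul_nonneg r) (by linarith)
    _ = 2 * (1 + Real.log 3 / Real.log (Real.log 3)) * lnTimesLnLn r := by
        rw [lnTimesLnLn]
        ring

theorem div_sqrt_sub_one_sq_le {γ : ℝ} (h1 : 1 < γ) (h2 : γ ≤ 2) :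
    γ / (√γ - 1) ^ 2 ≤ 18 / (γ - 1) ^ 2 := by
  have hsqrt : 1 < √γ := Real.lt_sqrt_of_sq_lt (by simpa using h1)
  have hsqrt2 : √γ ≤ 2 := Real.sqrt_le_iff.2 (by constructor <;> linarith)
  have hfactor : (γ - 1) = (√γ - 1) * (√γ + 1) := by
    linear_combination -Real.sq_sqrt (zero_le_one.trans h1.le)
  have hpos : 0 < √γ - 1 := by linarith
  rw [hfactor, mul_pow, div_le_div_iff₀ (pow_pos hpos 2) (by positivity)]
  calc γ * ((√γ - 1) ^ 2 * (√γ + 1) ^ 2) ≤ 2 * ((√γ - 1) ^ 2 * (2 + 1) ^ 2) := by gcongr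
    _ = 18 * (√γ - 1) ^ 2 := by ring

end LogBounds

section Guarantees

variable {V : Type u} {I : NodeMulticut V} {x : V → ℝ} {y : Fin I.r → V → ℝ} {Z : Finset V}

theorem one_lt_div_sub_one (hk : 2 ≤ I.k) : 1 < (I.k : ℝ) / ((I.k : ℝ) - 1) := by
  rw [one_lt_div (k_sub_one_pos hk)]
  exact sub_one_lt _

theorem rate_factor_le (hk : 2 ≤ I.k) :
    (I.k : ℝ) / ((I.k : ℝ) - 1) / (√((I.k : ℝ) / ((I.k : ℝ) - 1)) - 1) ^ 2 ≤
      18 * ((I.k : ℝ) - 1) ^ 2 := by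
  have hk' := k_sub_one_pos hk
  have hk2 : (2 : ℝ) ≤ I.k := Nat.ofNat_le_cast.2 hk
  refine (div_sqrt_sub_one_sq_le (one_lt_div_sub_one hk) ?_).trans_eq ?_
  · rw [div_le_iff₀ hk']
    linarith
  · field_simp
    ring

variable [Fintype V] [DecidableEq V]

theorem exists_card_le : ∃ c : ℝ, 0 < c ∧ ∀ (V : Type u) [Fintype V] [DecidableEq V]
    (I : NodeMulticut V), 2 ≤ I.k → ∀ (x : V → ℝ) (y : Fin I.r → V → ℝ), I.LPFeasible x y →
      ∀ γ : ℝ, 1 < γ → ∀ Z : Finset V, I.Returns x y γ Finset.univ Finset.univ Z →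
        (Z.card : ℝ) ≤ c * (γ / (√γ - 1) ^ 2 * lnTimesLnLn I.r) * ∑ v, x v := by
  obtain ⟨c, hc, hlog⟩ := exists_log_mul_log_log_le
  refine ⟨16 * c, by positivity, fun V _ _ I hk x y h γ hγ Z hZ => ?_⟩
  have hopt : 0 ≤ ∑ v, x v := Finset.sum_nonneg fun v _ => h.x_nonneg v
  calc (Z.card : ℝ) ≤ I.rate γ * I.callBound x Finset.univ Finset.univ := hZ.cost_le h hk hγ
    _ ≤ I.rate γ * (8 * (∑ v, x v) * Real.log (I.r + 1)) := by
        gcongr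
        exacts [rate_nonneg (by linarith), callBound_univ_le h.x_nonneg]
    _ = 16 * (γ / (√γ - 1) ^ 2) * (∑ v, x v) * (Real.log (I.r + 1)
          * Real.log (Real.log (Real.exp 1 * ((I.r : ℝ) + 1)))) := by
        rw [rate]
        ring
    _ ≤ 16 * (γ / (√γ - 1) ^ 2) * (∑ v, x v) * (c * lnTimesLnLn I.r) := by
        exact mul_le_mul_of_nonneg_left (hlog I.r) (by positivity)
    _ = 16 * c * (γ / (√γ - 1) ^ 2 * lnTimesLnLn I.r) * ∑ v, x v := by ring

theorem Returns.meetsConnectivity (hk : 2 ≤ I.k)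
    (hZ : I.Returns x y (I.k / ((I.k : ℝ) - 1)) Finset.univ Finset.univ Z) :
    I.MeetsConnectivity Z := fun i P hP => by
  have hk' := k_sub_one_pos hk
  have hlt := hZ.connLess (by rw [div_mul_cancel₀ _ hk'.ne']; linarith) i (Finset.mem_univ i) P hP
  rw [div_mul_cancel₀ _ hk'.ne', Nat.cast_lt] at hlt
  exact Nat.le_sub_one_of_lt hlt

end Guarantees

end NodeMulticut

theorem theorem5p8_general :
    ∃ C : ℝ, 0 < C ∧
      ∀ (V : Type u) [Fintype V] [DecidableEq V] (I : NodeMulticut V), 2 ≤ I.k →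
      ∀ (x : V → ℝ) (y : Fin I.r → V → ℝ), I.LPFeasible x y →
        (∀ γ : ℝ, 1 < γ →
          (∀ (S : Finset V) (i : Fin I.r),
            I.ConnAtLeast S (I.s i) (I.t i) (γ * ((I.k : ℝ) - 1)) →
              ∃ ρ : ℝ, I.GoodRadius x y γ S i ρ) ∧
          (∃ Z : Finset V, I.Returns x y γ Finset.univ Finset.univ Z) ∧
          ∀ Z : Finset V, I.Returns x y γ Finset.univ Finset.univ Z →
            (Z.card : ℝ) ≤ C * (γ / (√γ - 1) ^ 2 * lnTimesLnLn I.r) * ∑ v, x v ∧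
            ∀ i, I.ConnLess (Finset.univ \ Z) (I.s i) (I.t i) (γ * ((I.k : ℝ) - 1))) ∧
        (∀ Z : Finset V,
          I.Returns x y ((I.k : ℝ) / ((I.k : ℝ) - 1)) Finset.univ Finset.univ Z →
            (Z.card : ℝ) ≤ C * (((I.k : ℝ) - 1) ^ 2 * lnTimesLnLn I.r) * ∑ v, x v ∧
            I.MeetsConnectivity Z ∧
            (∀ v ∈ Z, I.IsTerminal v → ∃ i, 0 < y i v) ∧
            ((∀ i v, I.IsTerminal v → y i v = 0) → I.IsFeasible Z)) := by
  obtain ⟨c, hc, hcost⟩ := NodeMulticut.exists_card_le.{u}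
  refine ⟨18 * c, by positivity, fun V _ _ I hk x y h =>
    ⟨fun γ hγ => ⟨fun S i => NodeMulticut.exists_goodRadius h hk hγ,
      NodeMulticut.exists_returns h hk hγ _ _, fun Z hZ => ⟨?_, fun i =>
        hZ.connLess (mul_pos (by linarith) (NodeMulticut.k_sub_one_pos hk)) i (Finset.mem_univ i)⟩⟩,
    fun Z hZ => ⟨?_, hZ.meetsConnectivity hk, hZ.y_pos_of_terminal h, fun hy =>
      ⟨fun v hv hterm => ?_, hZ.meetsConnectivity hk⟩⟩⟩⟩
  all_goals
    have hopt : 0 ≤ ∑ v, x v := Finset.sum_nonneg fun v _ => h.x_nonneg v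
    have hΛ := NodeMulticut.lnTimesLnLn_nonneg I.r
  · refine (hcost V I hk x y h γ hγ Z hZ).trans ?_
    gcongr
    linarith
  · calc (Z.card : ℝ) ≤ _ := hcost V I hk x y h _ (NodeMulticut.one_lt_div_sub_one hk) Z hZ
      _ ≤ c * (18 * ((I.k : ℝ) - 1) ^ 2 * lnTimesLnLn I.r) * ∑ v, x v := by
          gcongr
          exact NodeMulticut.rate_factor_le hk
      _ = 18 * c * (((I.k : ℝ) - 1) ^ 2 * lnTimesLnLn I.r) * ∑ v, x v := by ring
  · obtain ⟨i, hi⟩ := hZ.y_pos_of_terminal h v hv hterm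
    exact hi.ne' (hy i v hterm)

theorem theorem5p8 :
    ∃ C : ℝ, 0 < C ∧
      ∀ (V : Type u) [Fintype V] [DecidableEq V] (I : NodeMulticut V), 2 ≤ I.k →
      ∀ (x : V → ℝ) (y : Fin I.r → V → ℝ), I.LPOptimal x y →
        (∀ γ : ℝ, 1 < γ →
          -- the algorithm never gets stuck, and it has an output
          (∀ (S : Finset V) (i : Fin I.r),
            I.ConnAtLeast S (I.s i) (I.t i) (γ * ((I.k : ℝ) - 1)) →
              ∃ ρ : ℝ, I.GoodRadius x y γ S i ρ) ∧
          (∃ Z : Finset V, I.Returns x y γ Finset.univ Finset.univ Z) ∧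
          -- every output has the claimed cost and connectivity
          ∀ Z : Finset V, I.Returns x y γ Finset.univ Finset.univ Z →
            (Z.card : ℝ) ≤ C * (γ / (√γ - 1) ^ 2 * lnTimesLnLn I.r) * ∑ v, x v ∧
            ∀ i, I.ConnLess (Finset.univ \ Z) (I.s i) (I.t i) (γ * ((I.k : ℝ) - 1))) ∧
        (∀ Z : Finset V,
          I.Returns x y ((I.k : ℝ) / ((I.k : ℝ) - 1)) Finset.univ Finset.univ Z →
            (Z.card : ℝ) ≤ C * (((I.k : ℝ) - 1) ^ 2 * lnTimesLnLn I.r) * ∑ v, x v ∧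
            I.MeetsConnectivity Z ∧
            -- terminals are deleted only if the LP solution puts `y`-weight on them
            (∀ v ∈ Z, I.IsTerminal v → ∃ i, 0 < y i v) ∧
            ((∀ i v, I.IsTerminal v → y i v = 0) → I.IsFeasible Z)) := by
  obtain ⟨C, hC, h⟩ := theorem5p8_general.{u}
  exact ⟨C, hC, fun V _ _ I hk x y hopt => h V I hk x y hopt.1⟩
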